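/- Let $Q$ be a free abelian group with a total order compatible with addition, and let $\pi:Q\to\mathbb Z$ be an order-preserving group homomorphism. Let $\mathfrak g=\bigoplus_{\alpha\in Q}\mathfrak g_\alpha$ be a $Q$-graded complex Lie algebra, i.e. $[\mathfrak g_\alpha,\mathfrak g_\beta]\subseteq\mathfrak g_{\alpha+\beta}$, with center $Z$. Put $\mathfrak n=\bigoplus_{\pi(\alpha)>0}\mathfrak g_\alpha$, $\mathfrak b_-=\bigoplus_{\pi(\alpha)\le 0}\mathfrak g_\alpha$, $Z''=Z\cap\mathfrak b_-$, and let $S(Z'')$ be the symmetric algebra of $Z''$, regarded as a subalgebra of the center of the universal enveloping algebra $U(\mathfrak g)$. Assume that $\mathfrak g$ is $Q$-good: $\dim\mathfrak g_\alpha\le 1$ whenever $\pi(\alpha)>0$, and $\dim(\mathfrak g/Z)_\alpha\le 1$ whenever $\pi(\alpha)\le 0$, where $(\mathfrak g/Z)_\alpha$ is the image of $\mathfrak g_\alpha$ in $\mathfrak g/Z$. Let $\varphi:\mathfrak n\to\mathbb C$ be a homomorphism of Lie algebras, and assume that $(\mathfrak g,\pi)$ is nonsingular with respect to $\varphi$: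 the set of all $\alpha\in Q$ with $\pi(\alpha)>0$ and $\varphi|_{\mathfrak g_\alpha}\ne 0$ has a (necessarily unique) maximal element $\alpha_\varphi$, and for every $\beta\in Q$ with $\pi(\beta)\le 0$ and every $x\in\mathfrak g_\beta\setminus Z$ there is a $y\in\mathfrak g_{\alpha_\varphi-\beta}$ with $[y,x]\in\mathfrak n$ and $\varphi([y,x])\neq 0$. A $\mathfrak g$-module $V$ is a Whittaker module of type $\varphi$ if it is generated by a vector $v$ with $xv=\varphi(x)v$ for all $x\in\mathfrak n$ (the zero module is allowed). Let $\mathbb C_\varphi$ be the one-dimensional $\mathfrak n$-module given by $\varphi$, let $M_\varphi=U(\mathfrak g)\otimes_{U(\mathfrak n)}\mathbb C_\varphi$, and for a $\mathfrak g$-module $V$ let $A_V=S(Z'')\cap\mathrm{Ann}_{U(\mathfrak g)}(V)$. Then $V\mapsto A_V$ induces a bijection from the set of isomorphism classes of Whittaker modules of type $\varphi$ onto the set of all ideals of $S(Z'')$. Its inverse sends an ideal $I$ to the isomorphism class of $M_\varphi/IM_\varphi$. -/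

import Mathlib

open scoped TensorProduct

attribute [local instance 100] LieRing.ofAssociativeRing

noncomputable section

namespace GradedWhittaker

universe u v w w'

/-! ### The decomposition of a graded Lie algebra -/

section Grading

variable {Q : Type v} [AddCommGroup Q] [LinearOrder Q]
variable {g : Type u} [LieRing g] [LieAlgebra ℂ g]

/-- `𝔤_m`, the sum of the `𝔤_α` over all `α` with `π α = m`. -/
def degreePart (𝔤 : Q → Submodule ℂ g) (π : Q →+o ℤ) (m : ℤ) : Submodule ℂ g :=
  ⨆ α : {α : Q // π α = m}, 𝔤 α

/-- The sum of the `𝔤_m` over all integers `m` with `P m`. -/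
def partSum (𝔤 : Q → Submodule ℂ g) (π : Q →+o ℤ) (P : ℤ → Prop) : Submodule ℂ g :=
  ⨆ m : {m : ℤ // P m}, degreePart 𝔤 π m

lemma mem_partSum {𝔤 : Q → Submodule ℂ g} {π : Q →+o ℤ} {P : ℤ → Prop} {α : Q} (hα : P (π α))
    {x : g} (hx : x ∈ 𝔤 α) : x ∈ partSum 𝔤 π P :=
  Submodule.mem_iSup_of_mem (⟨π α, hα⟩ : {m : ℤ // P m})
    (Submodule.mem_iSup_of_mem (⟨α, rfl⟩ : {β : Q // π β = π α}) hx)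

lemma partSum_le {𝔤 : Q → Submodule ℂ g} {π : Q →+o ℤ} {P : ℤ → Prop} {N : Submodule ℂ g}
    (h : ∀ α, P (π α) → 𝔤 α ≤ N) : partSum 𝔤 π P ≤ N := by
  refine iSup_le fun m => iSup_le fun α => ?_
  refine h α ?_
  rw [α.2]
  exact m.2

lemma lie_mem_partSum {𝔤 : Q → Submodule ℂ g} [SetLike.GradedBracket 𝔤] {π : Q →+o ℤ}
    {P : ℤ → Prop} (hP : ∀ m k, P m → P k → P (m + k)) {x y : g}
    (hx : x ∈ partSum 𝔤 π P) (hy : y ∈ partSum 𝔤 π P) : ⁅x, y⁆ ∈ partSum 𝔤 π P := by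
  have h1 : partSum 𝔤 π P ≤ (partSum 𝔤 π P).comap
      ((LieModule.toEnd ℂ g g).toLinearMap.flip y) := by
    refine partSum_le fun α hα a ha => ?_
    have h2 : partSum 𝔤 π P ≤ (partSum 𝔤 π P).comap (LieModule.toEnd ℂ g g a) := by
      refine partSum_le fun β hβ b hb => ?_
      refine mem_partSum (α := α + β) ?_ (SetLike.GradedBracket.bracket_mem ha hb)
      rw [map_add]
      exact hP _ _ hα hβ
    exact h2 hy
  exact h1 hx

variable (𝔤 : Q → Submodule ℂ g) [SetLike.GradedBracket 𝔤] (π : Q →+o ℤ)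

/-- The subalgebra `𝔫`, the sum of the `𝔤_m` with `m > 0`. -/
def nPos : LieSubalgebra ℂ g where
  toSubmodule := partSum 𝔤 π (fun m => 0 < m)
  lie_mem' := lie_mem_partSum fun _ _ hm hk => add_pos hm hk

/-- The subalgebra `𝔟₋`, the sum of the `𝔤_m` with `m ≤ 0`. -/
def bNeg : LieSubalgebra ℂ g where
  toSubmodule := partSum 𝔤 π (fun m => m ≤ 0)
  lie_mem' := lie_mem_partSum fun _ _ hm hk => add_nonpos hm hk

/-- `Z'' = Z ∩ 𝔟₋`, where `Z` is the center of the Lie algebra. -/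
def centerNeg : Submodule ℂ g :=
  (LieAlgebra.center ℂ g).toSubmodule ⊓ (bNeg 𝔤 π).toSubmodule

/-- `Q`-good: `dim 𝔤_α ≤ 1` if `π α > 0`, and `dim (𝔤 / Z)_α ≤ 1` if `π α ≤ 0`. Here `(𝔤 / Z)_α`
is the image of `𝔤_α` in `𝔤 / Z`. -/
structure IsQGood (𝔤 : Q → Submodule ℂ g) (π : Q →+o ℤ) : Prop where
  rank_pos : ∀ α, 0 < π α → Module.rank ℂ (𝔤 α) ≤ 1
  rank_nonpos : ∀ α, π α ≤ 0 →
    Module.rank ℂ ((𝔤 α).map (LieAlgebra.center ℂ g).toSubmodule.mkQ) ≤ 1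

/-- `(𝔤, π)` is nonsingular with respect to the character `φ` of `𝔫`: there is a maximal `α_φ`
among the `α` with `π α > 0` on whose `𝔤_α` the character `φ` does not vanish (the order of `Q`
being total, it is unique), and for each noncentral `x ∈ 𝔤_β` with `π β ≤ 0` there is a
`y ∈ 𝔤_{α_φ - β}` with `φ [y, x] ≠ 0`. -/
def IsNonsingular (φ : nPos 𝔤 π →ₗ⁅ℂ⁆ ℂ) : Prop :=
  ∃ αφ : Q,
    Maximal (fun α => 0 < π α ∧ ∃ x : nPos 𝔤 π, (x : g) ∈ 𝔤 α ∧ φ x ≠ 0) αφ ∧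
    ∀ β, π β ≤ 0 → ∀ x ∈ 𝔤 β, x ∉ LieAlgebra.center ℂ g →
      ∃ y ∈ 𝔤 (αφ - β), ∃ h : ⁅y, x⁆ ∈ nPos 𝔤 π, φ ⟨⁅y, x⁆, h⟩ ≠ 0

end Grading

/-! ### The action of the enveloping algebra -/

section Enveloping

variable (g : Type u) [LieRing g] [LieAlgebra ℂ g]

/-- The universal enveloping algebra. -/
abbrev Env : Type u := UniversalEnvelopingAlgebra ℂ g

/-- The action of the enveloping algebra on a `𝔤`-module. -/
def envAction (V : Type w) [AddCommGroup V] [Module ℂ V] [LieRingModule g V] [LieModule ℂ g V] :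
    Env g →ₐ[ℂ] Module.End ℂ V :=
  UniversalEnvelopingAlgebra.lift ℂ (LieModule.toEnd ℂ g V)

/-- The annihilator of a `𝔤`-module in the enveloping algebra. -/
def envAnn (V : Type w) [AddCommGroup V] [Module ℂ V] [LieRingModule g V] [LieModule ℂ g V] :
    Ideal (Env g) :=
  RingHom.ker (envAction g V)

variable {g}

/-- The enveloping algebra is generated by the Lie algebra. -/
lemma mem_of_ι_mem (S : Subalgebra ℂ (Env g)) (key : ∀ x : g, UniversalEnvelopingAlgebra.ι ℂ x ∈ S)
    (a : Env g) : a ∈ S := by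
  let f : g →ₗ⁅ℂ⁆ S :=
    { toFun := fun x => ⟨UniversalEnvelopingAlgebra.ι ℂ x, key x⟩
      map_add' := fun x y => Subtype.ext (map_add _ x y)
      map_smul' := fun c x => Subtype.ext (map_smul _ c x)
      map_lie' := fun {x y} => Subtype.ext ((UniversalEnvelopingAlgebra.ι ℂ).map_lie x y) }
  have hf : S.val.comp (UniversalEnvelopingAlgebra.lift ℂ f) = AlgHom.id ℂ (Env g) := by
    refine UniversalEnvelopingAlgebra.hom_ext ℂ (LieHom.ext fun x => ?_)
    change ((UniversalEnvelopingAlgebra.lift ℂ f (UniversalEnvelopingAlgebra.ι ℂ x) : S) : Env g)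
      = UniversalEnvelopingAlgebra.ι ℂ x
    rw [UniversalEnvelopingAlgebra.lift_ι_apply]
    rfl
  have h := DFunLike.congr_fun hf a
  rw [AlgHom.id_apply] at h
  rw [← h]
  exact (UniversalEnvelopingAlgebra.lift ℂ f a).2

lemma ι_mem_center {z : g} (hz : z ∈ LieAlgebra.center ℂ g) :
    UniversalEnvelopingAlgebra.ι ℂ z ∈ Subalgebra.center ℂ (Env g) := by
  rw [Subalgebra.mem_center_iff]
  intro a
  have ha := mem_of_ι_mem (Subalgebra.centralizer ℂ {UniversalEnvelopingAlgebra.ι ℂ z}) (by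
    intro x
    rw [Subalgebra.mem_centralizer_iff]
    rintro _ rfl
    have h0 : ⁅x, z⁆ = 0 := (LieModule.mem_maxTrivSubmodule ℂ g g z).1 hz x
    have h := (UniversalEnvelopingAlgebra.ι ℂ).map_lie x z
    rw [h0, map_zero, LieRing.of_associative_ring_bracket] at h
    exact (sub_eq_zero.1 h.symm).symm) a
  exact ((Subalgebra.mem_centralizer_iff ℂ).1 ha _ rfl).symm

lemma envAction_map {V : Type w} [AddCommGroup V] [Module ℂ V] [LieRingModule g V] [LieModule ℂ g V]
    {V' : Type w'} [AddCommGroup V'] [Module ℂ V'] [LieRingModule g V'] [LieModule ℂ g V']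
    (f : V →ₗ⁅ℂ,g⁆ V') (a : Env g) (v : V) : f (envAction g V a v) = envAction g V' a (f v) := by
  let S : Subalgebra ℂ (Env g) :=
    { carrier := {a | ∀ v, f (envAction g V a v) = envAction g V' a (f v)}
      mul_mem' := fun {a b} ha hb v => by
        rw [map_mul, map_mul, Module.End.mul_apply, Module.End.mul_apply, ha, hb]
      add_mem' := fun {a b} ha hb v => by
        rw [map_add, map_add, LinearMap.add_apply, LinearMap.add_apply, map_add, ha, hb]
      algebraMap_mem' := fun c v => by
        rw [AlgHom.commutes, AlgHom.commutes, Module.algebraMap_end_apply,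
          Module.algebraMap_end_apply, map_smul] }
  refine mem_of_ι_mem S (fun x v => ?_) a v
  rw [envAction, envAction, UniversalEnvelopingAlgebra.lift_ι_apply,
    UniversalEnvelopingAlgebra.lift_ι_apply]
  exact f.map_lie x v

end Enveloping

/-! ### The ring `S(Z'')` and the modules `M_φ / I M_φ` -/

section Modules

variable {Q : Type v} [AddCommGroup Q] [LinearOrder Q]
variable {g : Type u} [LieRing g] [LieAlgebra ℂ g]
variable (𝔤 : Q → Submodule ℂ g) [SetLike.GradedBracket 𝔤] (π : Q →+o ℤ)

/-- `A = S(Z'')`, the symmetric algebra of `Z''`. -/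
abbrev SZ : Type u := SymmetricAlgebra ℂ (centerNeg 𝔤 π)

/-- The inclusion of `Z''` into the center of the enveloping algebra. -/
def centerNegToEnv : centerNeg 𝔤 π →ₗ[ℂ] Subalgebra.center ℂ (Env g) :=
  LinearMap.codRestrict (Subalgebra.toSubmodule (Subalgebra.center ℂ (Env g)))
    ((UniversalEnvelopingAlgebra.ι ℂ).toLinearMap.comp (centerNeg 𝔤 π).subtype)
    (fun z => ι_mem_center z.2.1)

/-- The canonical map from `S(Z'')` to the enveloping algebra, through which `S(Z'')` is regarded
as a subalgebra of the latter. -/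
def SZToEnv : SZ 𝔤 π →ₐ[ℂ] Env g :=
  (Subalgebra.center ℂ (Env g)).val.comp (SymmetricAlgebra.lift (centerNegToEnv 𝔤 π))

/-- `A_V`, the intersection of `S(Z'')` with the annihilator of `V`. -/
def annIdeal (V : Type w) [AddCommGroup V] [Module ℂ V] [LieRingModule g V] [LieModule ℂ g V] :
    Ideal (SZ 𝔤 π) :=
  (envAnn g V).comap (SZToEnv 𝔤 π)

variable {𝔤 π} (φ : nPos 𝔤 π →ₗ⁅ℂ⁆ ℂ)

/-- `v` is a Whittaker vector: `x v = φ(x) v` for all `x ∈ 𝔫`. -/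
def IsWhittakerVector {V : Type w} [AddCommGroup V] [Module ℂ V] [LieRingModule g V] (v : V) :
    Prop :=
  ∀ x : nPos 𝔤 π, ⁅(x : g), v⁆ = φ x • v

/-- `V` is a Whittaker module of type `φ`: it is generated by a Whittaker vector. -/
def IsWhittakerModule (V : Type w) [AddCommGroup V] [Module ℂ V] [LieRingModule g V]
    [LieModule ℂ g V] : Prop :=
  ∃ v : V, IsWhittakerVector φ v ∧ LieSubmodule.lieSpan ℂ g {v} = ⊤

/-- The extension of the character `φ` to `U(𝔫)`. -/
def charEnv : Env (nPos 𝔤 π) →ₐ[ℂ] ℂ := UniversalEnvelopingAlgebra.lift ℂ φ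

variable (𝔤 π) in
/-- The map `U(𝔫) → U(𝔤)` induced by the inclusion of `𝔫`. -/
def envIncl : Env (nPos 𝔤 π) →ₐ[ℂ] Env g :=
  UniversalEnvelopingAlgebra.lift ℂ ((UniversalEnvelopingAlgebra.ι ℂ).comp (nPos 𝔤 π).incl)

/-- The relations `u n ⊗ c = u ⊗ n c` of the tensor product over `U(𝔫)`, where `n ∈ U(𝔫)` acts on
`ℂ_φ = ℂ` through `φ`. -/
def balancedRel : Submodule (Env g) (Env g ⊗[ℂ] ℂ) :=
  Submodule.span (Env g)
    {t | ∃ (u : Env g) (n : Env (nPos 𝔤 π)) (c : ℂ),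
      t = (u * envIncl 𝔤 π n) ⊗ₜ[ℂ] c - u ⊗ₜ[ℂ] (charEnv φ n * c)}

/-- The induced module `M_φ`, the tensor product of `U(𝔤)` and `ℂ_φ` over `U(𝔫)`. -/
def Mφ : Type u := (Env g ⊗[ℂ] ℂ) ⧸ balancedRel φ

instance : AddCommGroup (Mφ φ) :=
  inferInstanceAs (AddCommGroup ((Env g ⊗[ℂ] ℂ) ⧸ balancedRel φ))

instance : Module (Env g) (Mφ φ) :=
  inferInstanceAs (Module (Env g) ((Env g ⊗[ℂ] ℂ) ⧸ balancedRel φ))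

instance : Module ℂ (Mφ φ) :=
  inferInstanceAs (Module ℂ ((Env g ⊗[ℂ] ℂ) ⧸ balancedRel φ))

instance : IsScalarTower ℂ (Env g) (Mφ φ) :=
  inferInstanceAs (IsScalarTower ℂ (Env g) ((Env g ⊗[ℂ] ℂ) ⧸ balancedRel φ))

/-- `𝔤` acts on `M_φ` through its enveloping algebra. -/
instance : LieRingModule g (Mφ φ) where
  bracket x m := UniversalEnvelopingAlgebra.ι ℂ x • m
  add_lie x y m := by
    rw [map_add, add_smul]
  lie_add x m m' := smul_add _ m m'
  leibniz_lie x y m := by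
    change UniversalEnvelopingAlgebra.ι ℂ x • UniversalEnvelopingAlgebra.ι ℂ y • m =
      UniversalEnvelopingAlgebra.ι ℂ ⁅x, y⁆ • m +
        UniversalEnvelopingAlgebra.ι ℂ y • UniversalEnvelopingAlgebra.ι ℂ x • m
    rw [LieHom.map_lie, LieRing.of_associative_ring_bracket, sub_smul, mul_smul, mul_smul,
      sub_add_cancel]

lemma lie_eq_smul (x : g) (m : Mφ φ) : ⁅x, m⁆ = UniversalEnvelopingAlgebra.ι ℂ x • m := rfl

instance : LieModule ℂ g (Mφ φ) where
  smul_lie c x m := by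
    rw [lie_eq_smul, lie_eq_smul, map_smul, smul_assoc]
  lie_smul c x m := by
    rw [lie_eq_smul, lie_eq_smul, ← algebraMap_smul (Env g) c m, ← mul_smul,
      ← Algebra.commutes, mul_smul, algebraMap_smul]

/-- The generator `w = 1 ⊗ 1` of `M_φ`. -/
def wφ : Mφ φ := Submodule.Quotient.mk ((1 : Env g) ⊗ₜ[ℂ] (1 : ℂ))

/-- `I M_φ`, the submodule of `M_φ` generated by the `p m` with `p ∈ I` and `m ∈ M_φ`. -/
def idealMul (I : Ideal (SZ 𝔤 π)) : LieSubmodule ℂ g (Mφ φ) :=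
  LieSubmodule.lieSpan ℂ g {m' | ∃ p ∈ I, ∃ m : Mφ φ, m' = SZToEnv 𝔤 π p • m}

/-- `L_{φ, I} = M_φ / I M_φ`. -/
abbrev Lφ (I : Ideal (SZ 𝔤 π)) : Type u := Mφ φ ⧸ idealMul φ I

lemma isWhittakerVector_wφ : IsWhittakerVector φ (wφ φ) := by
  intro x
  have h : (UniversalEnvelopingAlgebra.ι ℂ (x : g) ⊗ₜ[ℂ] (1 : ℂ) - (1 : Env g) ⊗ₜ[ℂ] φ x :
      Env g ⊗[ℂ] ℂ) ∈ balancedRel φ := by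
    refine Submodule.subset_span ⟨1, UniversalEnvelopingAlgebra.ι ℂ x, 1, ?_⟩
    rw [one_mul, mul_one, charEnv, envIncl, UniversalEnvelopingAlgebra.lift_ι_apply,
      UniversalEnvelopingAlgebra.lift_ι_apply]
    rfl
  have h' := (Submodule.Quotient.eq (balancedRel φ)).2 h
  have h1 : ⁅(x : g), wφ φ⁆ = (Submodule.Quotient.mk
      (UniversalEnvelopingAlgebra.ι ℂ (x : g) ⊗ₜ[ℂ] (1 : ℂ)) :
        (Env g ⊗[ℂ] ℂ) ⧸ balancedRel φ) := by
    rw [lie_eq_smul, wφ]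
    change (Submodule.Quotient.mk (UniversalEnvelopingAlgebra.ι ℂ (x : g) •
      ((1 : Env g) ⊗ₜ[ℂ] (1 : ℂ))) : (Env g ⊗[ℂ] ℂ) ⧸ balancedRel φ) = _
    rw [TensorProduct.smul_tmul', smul_eq_mul, mul_one]
  have h2 : φ x • wφ φ = (Submodule.Quotient.mk ((1 : Env g) ⊗ₜ[ℂ] φ x) :
        (Env g ⊗[ℂ] ℂ) ⧸ balancedRel φ) := by
    change (Submodule.Quotient.mk (φ x • ((1 : Env g) ⊗ₜ[ℂ] (1 : ℂ))) :
      (Env g ⊗[ℂ] ℂ) ⧸ balancedRel φ) = _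
    rw [← TensorProduct.tmul_smul, smul_eq_mul, mul_one]
  rw [h1, h2]
  exact h'

lemma envAction_Mφ (a : Env g) (m : Mφ φ) : envAction g (Mφ φ) a m = a • m := by
  have h : envAction g (Mφ φ) = Algebra.lsmul ℂ ℂ (Mφ φ) := by
    refine UniversalEnvelopingAlgebra.hom_ext ℂ (LieHom.ext fun x => LinearMap.ext fun m => ?_)
    change envAction g (Mφ φ) (UniversalEnvelopingAlgebra.ι ℂ x) m = _
    rw [envAction, UniversalEnvelopingAlgebra.lift_ι_apply]
    rfl
  rw [h]
  rfl

lemma lieSpan_wφ : LieSubmodule.lieSpan ℂ g {wφ φ} = ⊤ := by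
  set N := LieSubmodule.lieSpan ℂ g {wφ φ}
  have hw : wφ φ ∈ N := LieSubmodule.subset_lieSpan rfl
  have hN : ∀ a : Env g, a • wφ φ ∈ N := by
    intro a
    have h := envAction_map N.incl a ⟨wφ φ, hw⟩
    rw [envAction_Mφ] at h
    have h' := (envAction g N a ⟨wφ φ, hw⟩).2
    rwa [← LieSubmodule.incl_apply, h] at h'
  refine eq_top_iff.2 fun m _ => ?_
  obtain ⟨t, rfl⟩ := Submodule.Quotient.mk_surjective (balancedRel φ) m
  induction t using TensorProduct.induction_on with
  | zero => exact N.zero_mem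
  | tmul u c =>
    have h := hN (c • u)
    have e : (c • u) ⊗ₜ[ℂ] (1 : ℂ) = u ⊗ₜ[ℂ] c := by
      rw [TensorProduct.smul_tmul, smul_eq_mul, mul_one]
    have e' : (c • u) • wφ φ = (Submodule.Quotient.mk (u ⊗ₜ[ℂ] c) :
        (Env g ⊗[ℂ] ℂ) ⧸ balancedRel φ) := by
      change (Submodule.Quotient.mk ((c • u) • ((1 : Env g) ⊗ₜ[ℂ] (1 : ℂ))) :
        (Env g ⊗[ℂ] ℂ) ⧸ balancedRel φ) = _
      rw [TensorProduct.smul_tmul', smul_eq_mul, mul_one, e]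
    rw [e'] at h
    exact h
  | add s t hs ht => exact N.add_mem (hs trivial) (ht trivial)

lemma isWhittakerModule_Lφ (I : Ideal (SZ 𝔤 π)) : IsWhittakerModule φ (Lφ φ I) := by
  let p := LieSubmodule.Quotient.mk' (idealMul φ I)
  refine ⟨p (wφ φ), fun x => ?_, ?_⟩
  · rw [← p.map_lie, isWhittakerVector_wφ φ x, map_smul]
  · set N := LieSubmodule.lieSpan ℂ g {p (wφ φ)}
    have h : (⊤ : LieSubmodule ℂ g (Mφ φ)) ≤ N.comap p := by
      rw [← lieSpan_wφ, LieSubmodule.lieSpan_le]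
      rintro _ rfl
      exact LieSubmodule.subset_lieSpan rfl
    refine eq_top_iff.2 fun v _ => ?_
    obtain ⟨m, rfl⟩ := LieSubmodule.Quotient.surjective_mk' (idealMul φ I) v
    exact h (LieSubmodule.mem_top m)

/-! ### Isomorphism classes -/

/-- A Whittaker module of type `φ`, bundled. -/
structure WhittakerModule where
  /-- The underlying vector space. -/
  carrier : Type u
  [addCommGroup : AddCommGroup carrier]
  [module : Module ℂ carrier]
  [lieRingModule : LieRingModule g carrier]
  [lieModule : LieModule ℂ g carrier]
  isWhittakerModule : IsWhittakerModule φ carrier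

attribute [instance] WhittakerModule.addCommGroup WhittakerModule.module
  WhittakerModule.lieRingModule WhittakerModule.lieModule

/-- Isomorphism of `𝔤`-modules, as an equivalence relation on Whittaker modules of type `φ`. -/
instance isoSetoid : Setoid (WhittakerModule φ) where
  r V V' := Nonempty (V.carrier ≃ₗ⁅ℂ,g⁆ V'.carrier)
  iseqv :=
    { refl := fun _ => ⟨LieModuleEquiv.refl⟩
      symm := fun ⟨e⟩ => ⟨e.symm⟩
      trans := fun ⟨e⟩ ⟨e'⟩ => ⟨e.trans e'⟩ }

/-- The isomorphism classes of Whittaker modules of type `φ`. -/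
def WhittakerClass : Type (u + 1) := Quotient (isoSetoid φ)

lemma annIdeal_le {V : Type w} [AddCommGroup V] [Module ℂ V] [LieRingModule g V] [LieModule ℂ g V]
    {V' : Type w'} [AddCommGroup V'] [Module ℂ V'] [LieRingModule g V'] [LieModule ℂ g V']
    (e : V ≃ₗ⁅ℂ,g⁆ V') : annIdeal 𝔤 π V ≤ annIdeal 𝔤 π V' := by
  intro a ha
  have ha' : envAction g V (SZToEnv 𝔤 π a) = 0 := ha
  change envAction g V' (SZToEnv 𝔤 π a) = 0
  refine LinearMap.ext fun v => ?_
  have h := envAction_map e.toLieModuleHom (SZToEnv 𝔤 π a) (e.symm v)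
  rw [ha', LinearMap.zero_apply, map_zero] at h
  have h' : e.toLieModuleHom (e.symm v) = v := e.apply_symm_apply v
  rw [h'] at h
  exact h.symm

/-- The map sending the isomorphism class of `V` to `A_V`. -/
def annClass : WhittakerClass φ → Ideal (SZ 𝔤 π) :=
  Quotient.lift (fun V => annIdeal 𝔤 π V.carrier)
    fun _ _ ⟨e⟩ => le_antisymm (annIdeal_le e) (annIdeal_le e.symm)

/-- The map sending an ideal `I` to the isomorphism class of `M_φ / I M_φ`. -/
def idealClass (I : Ideal (SZ 𝔤 π)) : WhittakerClass φ :=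
  Quotient.mk (isoSetoid φ) ⟨Lφ φ I, isWhittakerModule_Lφ φ I⟩

end Modules

end GradedWhittaker

end

/-! Two facts are used throughout. `M_φ` is universal among modules with a Whittaker vector
(`exists_lieModuleHom_of_isWhittakerVector`), and `S(Z'')` acts by operators commuting with `𝔤`, so
an element of it kills a module as soon as it kills a generator (`mem_annIdeal_of_generator`).

The annihilator of `M_φ / I M_φ` is `I` (`annIdeal_Lφ`). With `R = S(Z'')/I`, it suffices to find a
module with a Whittaker vector `f` on which `S(Z'')` acts through `R`, such that `r f = 0` forces `r
= 0`; then `M_φ / I M_φ` maps to it. Such an `f` lives in the coinduced module `Hom(U(𝔤), R)`,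
modelled by functions on words in a basis of `𝔤` that respect `x y - y x = [x, y]`. It is a
functional with `f(1) = 1` and `f(u h) = f(u) χ(h)` for `h` in `𝔫 + Z''`, where `χ` combines `φ`
with `Z'' → R`. It is computed by straightening words, and is well defined by a diamond-lemma
argument resting on the Jacobi identity (`swapRel_straighten`); this plays the role of the
Poincaré–Birkhoff–Witt theorem.

Conversely `V ≅ M_φ / A_V M_φ` (`nonempty_Lφ_annIdeal_equiv`). Goodness leaves at most one element
`x_β` of each degree of `𝔟₋` modulo `Z''`. The monomials in the `x_β` applied to the generator `v`
span `V` over `S(Z'')` (`span_monVec_eq_top`), and they are independent up to coefficients that kill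
`v` (`smul_eq_zero_of_sum_eq_zero`). Hence the coefficients of any element of the kernel of `M_φ →
V` lie in `A_V`.

For the independence, give `x_β` the weight `π(α_φ) - π(β) > 0`. Modulo lower weight the letters
commute, and for `y` of degree `α_φ - β` the operator `y - φ(y)` acts on monomials with letters `≥
β` as `φ([y, x_β])` times the derivative in `x_β`. Nonsingularity provides a `y` with nonzero
scalar, so differentiating in the smallest letter allows induction on the weight. -/

noncomputable section

namespace GradedWhittaker

universe u v w w'

/-! ### Straightening words in a basis of a Lie algebra -/

section Straightening

variable {k : Type*} [CommRing k] {L : Type*} [LieRing L] [LieAlgebra k L]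
variable {ι : Type*} (B : Module.Basis ι k L)
variable {R : Type*} [CommRing R] [Algebra k R]

/-- For a function `f` on words in a basis, the linear map sending a linear combination of basis
elements to the same linear combination of the values of `f` at `a ++ i :: b`. -/
def slot (f : List ι → R) (a b : List ι) : L →ₗ[k] R :=
  B.constr k fun i => f (a ++ i :: b)

lemma slot_basis (f : List ι → R) (a b : List ι) (i : ι) :
    slot B f a b (B i) = f (a ++ i :: b) :=
  B.constr_basis k _ i

/-- The relation `f (a x y b) = f (a y x b) + f (a [x, y] b)`. -/
def SwapRel (f : List ι → R) (a : List ι) (x y : ι) (b : List ι) : Prop :=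
  f (a ++ x :: y :: b) = f (a ++ y :: x :: b) + slot B f a b ⁅B x, B y⁆

variable {B}

lemma SwapRel.symm {f : List ι → R} {a : List ι} {x y : ι} {b : List ι} (h : SwapRel B f a x y b) :
    SwapRel B f a y x b := by
  unfold SwapRel at *
  rw [h, ← lie_skew, map_neg]
  ring

lemma SwapRel.refl (f : List ι → R) (a : List ι) (x : ι) (b : List ι) : SwapRel B f a x x b := by
  unfold SwapRel
  rw [lie_self, map_zero, add_zero]

/-- The swap relation is linear in its first letter, so it extends from basis elements to all
vectors. This is what makes sense of moving a letter past a bracket. -/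
lemma slot_lie {f : List ι → R} {a b : List ι} {y : ι} (h : ∀ x, SwapRel B f a x y b) (v : L) :
    slot B f a (y :: b) v = slot B f (a ++ [y]) b v + slot B f a b ⁅v, B y⁆ := by
  have e : slot B f a (y :: b) = slot B f (a ++ [y]) b +
      slot B f a b ∘ₗ (LieModule.toEnd k L L : L →ₗ[k] Module.End k L).flip (B y) := by
    refine B.ext fun x => ?_
    have h' := h x
    unfold SwapRel at h'
    simpa [slot_basis] using h'
  rw [e]
  rfl

/-- The two ways of straightening a word with two disjoint descents agree. -/
lemma confluent_of_disjoint {f : List ι → R} {a c b : List ι} {x y x' y' : ι}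
    (h1 : SwapRel B f (a ++ y :: x :: c) x' y' b)
    (h2 : SwapRel B f a x y (c ++ y' :: x' :: b))
    (h3 : ∀ i, SwapRel B f (a ++ i :: c) x' y' b)
    (h4 : ∀ i, SwapRel B f a x y (c ++ i :: b)) :
    f (a ++ y :: x :: (c ++ x' :: y' :: b)) + slot B f a (c ++ x' :: y' :: b) ⁅B x, B y⁆ =
      f (a ++ x :: y :: (c ++ y' :: x' :: b)) + slot B f (a ++ x :: y :: c) b ⁅B x', B y'⁆ := by
  have e1 : slot B f a (c ++ x' :: y' :: b) = slot B f a (c ++ y' :: x' :: b) +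
      B.constr k (fun i => slot B f (a ++ i :: c) b ⁅B x', B y'⁆) := by
    refine B.ext fun i => ?_
    have h := h3 i
    unfold SwapRel at h
    simpa [slot_basis] using h
  have e2 : slot B f (a ++ x :: y :: c) b = slot B f (a ++ y :: x :: c) b +
      B.constr k (fun i => slot B f a (c ++ i :: b) ⁅B x, B y⁆) := by
    refine B.ext fun i => ?_
    have h := h4 i
    unfold SwapRel at h
    simpa [slot_basis] using h
  -- The terms with both descents replaced by brackets form one bilinear function of the two
  -- brackets, whichever slot is expanded first.
  have e3 : (B.constr k (fun i => slot B f (a ++ i :: c) b) : L →ₗ[k] L →ₗ[k] R) =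
      (B.constr k (fun i => slot B f a (c ++ i :: b)) : L →ₗ[k] L →ₗ[k] R).flip := by
    refine B.ext fun i => B.ext fun j => ?_
    simp [slot_basis]
  have e4 : ∀ w v : L, B.constr k (fun i => slot B f (a ++ i :: c) b w) v =
      (B.constr k (fun i => slot B f (a ++ i :: c) b) : L →ₗ[k] L →ₗ[k] R) v w := by
    intro w v
    have : B.constr k (fun i => slot B f (a ++ i :: c) b w) =
        (B.constr k (fun i => slot B f (a ++ i :: c) b) : L →ₗ[k] L →ₗ[k] R).flip w :=
      B.ext fun i => by simp
    rw [this]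
    rfl
  have e5 : ∀ w v : L, B.constr k (fun i => slot B f a (c ++ i :: b) w) v =
      (B.constr k (fun i => slot B f a (c ++ i :: b)) : L →ₗ[k] L →ₗ[k] R) v w := by
    intro w v
    have : B.constr k (fun i => slot B f a (c ++ i :: b) w) =
        (B.constr k (fun i => slot B f a (c ++ i :: b)) : L →ₗ[k] L →ₗ[k] R).flip w :=
      B.ext fun i => by simp
    rw [this]
    rfl
  unfold SwapRel at h1 h2
  simp only [List.append_assoc, List.cons_append] at h1
  rw [e1, e2, h1, h2, LinearMap.add_apply, LinearMap.add_apply, e4, e5, e3, LinearMap.flip_apply]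
  ring

/-- The two ways of straightening a word with two overlapping descents agree, by the Jacobi
identity. -/
lemma confluent_of_overlap {f : List ι → R} {a b : List ι} {x y z : ι}
    (h1 : SwapRel B f (a ++ [y]) z x b) (h2 : SwapRel B f a y x (z :: b))
    (h3 : SwapRel B f a z x (y :: b)) (h4 : SwapRel B f (a ++ [x]) z y b)
    (h5 : ∀ i j, SwapRel B f a i j b) :
    f (a ++ y :: z :: x :: b) + slot B f a (x :: b) ⁅B z, B y⁆ =
      f (a ++ z :: x :: y :: b) + slot B f (a ++ [z]) b ⁅B y, B x⁆ := by
  -- After all swaps the two sides differ only by the commutators of each letter with the bracket of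
  -- the other two.
  have j1 := slot_lie (fun i => h5 i x) ⁅B z, B y⁆
  have j2 := slot_lie (fun i => h5 i z) ⁅B y, B x⁆
  have j3 := slot_lie (fun i => h5 i y) ⁅B z, B x⁆
  have j : ⁅⁅B z, B y⁆, B x⁆ + ⁅⁅B y, B x⁆, B z⁆ = ⁅⁅B z, B x⁆, B y⁆ := by
    rw [lie_lie (B z) (B y) (B x), ← lie_skew (B z) ⁅B y, B x⁆, ← lie_skew (B y) ⁅B z, B x⁆]
    abel
  have j' := congrArg (slot B f a b) j
  rw [map_add] at j'
  unfold SwapRel at h1 h2 h3 h4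
  simp only [List.append_assoc, List.cons_append, List.nil_append] at h1 h2 h3 h4
  rw [h1, h2, h3, h4]
  linear_combination j1 - j3 + j2 + j'

variable [LinearOrder ι]

/-- The number of inversions of a word. -/
def inversions : List ι → ℕ
  | [] => 0
  | x :: l => l.countP (· < x) + inversions l

lemma inversions_swap_lt {x y : ι} (h : y < x) (a b : List ι) :
    inversions (a ++ y :: x :: b) < inversions (a ++ x :: y :: b) := by
  induction a with
  | nil =>
    simp only [List.nil_append, inversions, List.countP_cons, h, not_lt_of_gt h, decide_true,
      decide_false]
    simp
    omega
  | cons c a ih =>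
    have hp : (a ++ y :: x :: b).Perm (a ++ x :: y :: b) := (List.Perm.swap x y b).append_left a
    simp only [List.cons_append, inversions, hp.countP_eq]
    omega

variable (B) (χ : L →ₗ[k] R) (H : Set ι)

open Classical in
/-- The value of a word under straightening: final letters `i` in `H` are replaced by the scalars
`χ (B i)`, descents are removed by means of the relation `x y = y x + [x, y]`, and the nonempty
words to which neither applies have value zero. -/
def straighten (l : List ι) : R :=
  if h : ∃ t : List ι × ι, t.2 ∈ H ∧ l = t.1 ++ [t.2] then
    straighten h.choose.1 * χ (B h.choose.2)
  else if h : ∃ t : List ι × ι × ι × List ι, t.2.2.1 < t.2.1 ∧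
      l = t.1 ++ t.2.1 :: t.2.2.1 :: t.2.2.2 then
    straighten (h.choose.1 ++ h.choose.2.2.1 :: h.choose.2.1 :: h.choose.2.2.2) +
      B.constr k (fun i => straighten (h.choose.1 ++ i :: h.choose.2.2.2))
        ⁅B h.choose.2.1, B h.choose.2.2.1⁆
  -- The words left over are nondecreasing. When `H` is an upper set they contain no letter of `H`,
  -- so they are the ordered monomials complementary to `H`, and the value is the coefficient of the
  -- empty one.
  else if l = [] then 1 else 0
-- Dropping a letter or forming a bracket shortens the word; a swap keeps the length and removes an
-- inversion.
termination_by (l.length, inversions l)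
decreasing_by
  · have e := congrArg List.length h.choose_spec.2
    rw [List.length_append, List.length_singleton] at e
    exact Prod.Lex.left _ _ (by omega)
  · have e := h.choose_spec.2
    have e' := inversions_swap_lt h.choose_spec.1 h.choose.1 h.choose.2.2.2
    rw [← e] at e'
    have e'' := congrArg List.length e
    refine Prod.lex_def.2 (Or.inr ⟨?_, e'⟩)
    rw [e'']
    simp
  · have e'' := congrArg List.length h.choose_spec.2
    refine Prod.Lex.left _ _ ?_
    rw [e'']
    simp

lemma straighten_nil : straighten B χ H [] = 1 := by
  rw [straighten, dif_neg, dif_neg, if_pos rfl]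
  · rintro ⟨t, -, h⟩
    simp at h
  · rintro ⟨t, -, h⟩
    simp at h

lemma straighten_append_singleton {i : ι} (hi : i ∈ H) (l : List ι) :
    straighten B χ H (l ++ [i]) = straighten B χ H l * χ (B i) := by
  have h : ∃ t : List ι × ι, t.2 ∈ H ∧ l ++ [i] = t.1 ++ [t.2] := ⟨(l, i), hi, rfl⟩
  have e := List.append_inj' h.choose_spec.2 rfl
  rw [straighten, dif_pos h, ← e.1, ← (List.singleton_inj.1 e.2)]

variable {χ H}

/-- A word with a descent and with no final letter in `H` can be straightened at some descent. -/
lemma exists_swapRel {l : List ι} (hH : ∀ l' i, i ∈ H → l ≠ l' ++ [i])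
    (hl : ∃ a x y b, y < x ∧ l = a ++ x :: y :: b) :
    ∃ a x y b, y < x ∧ l = a ++ x :: y :: b ∧ SwapRel B (straighten B χ H) a x y b := by
  have h : ∃ t : List ι × ι × ι × List ι, t.2.2.1 < t.2.1 ∧
      l = t.1 ++ t.2.1 :: t.2.2.1 :: t.2.2.2 := by
    obtain ⟨a, x, y, b, h⟩ := hl
    exact ⟨(a, x, y, b), h⟩
  refine ⟨h.choose.1, h.choose.2.1, h.choose.2.2.1, h.choose.2.2.2, h.choose_spec.1,
    h.choose_spec.2, ?_⟩
  unfold SwapRel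
  rw [← h.choose_spec.2, straighten, dif_neg (fun ⟨t, ht, ht'⟩ => hH t.1 t.2 ht ht'), dif_pos h]
  rfl

/-- Agreement of the two straightenings of a word at any two of its descents. -/
lemma confluent {f : List ι → R} {l : List ι}
    (hlen : ∀ a x y b, (a ++ x :: y :: b).length < l.length → SwapRel B f a x y b)
    (hinv : ∀ a x y b, y < x → (a ++ x :: y :: b).length = l.length →
      inversions (a ++ x :: y :: b) < inversions l → SwapRel B f a x y b)
    {a x y b a' x' y' b'} (hxy : y < x) (hl : l = a ++ x :: y :: b)
    (hxy' : y' < x') (hl' : l = a' ++ x' :: y' :: b') (c : List ι) (hc : a' = a ++ c) :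
    f (a ++ y :: x :: b) + slot B f a b ⁅B x, B y⁆ =
      f (a' ++ y' :: x' :: b') + slot B f a' b' ⁅B x', B y'⁆ := by
  subst hc
  rw [hl, List.append_assoc, List.append_cancel_left_eq] at hl'
  match c, hl' with
  | [], hl' =>
    simp only [List.nil_append, List.cons.injEq] at hl'
    obtain ⟨rfl, rfl, rfl⟩ := hl'
    simp
  | [u], hl' =>
    simp only [List.cons_append, List.nil_append, List.cons.injEq] at hl'
    obtain ⟨rfl, rfl, rfl⟩ := hl'
    have i1 := inversions_swap_lt hxy a (y' :: b')
    have i2 := inversions_swap_lt (hxy'.trans hxy) (a ++ [y]) b'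
    have i3 := inversions_swap_lt hxy' (a ++ [x]) b'
    have i4 := inversions_swap_lt (hxy'.trans hxy) a (y :: b')
    simp only [List.append_assoc, List.cons_append, List.nil_append] at i1 i2 i3 i4
    have := confluent_of_overlap (B := B) (f := f) (a := a) (b := b') (x := y') (y := y) (z := x)
      (hinv _ _ _ _ (hxy'.trans hxy) (by simp [hl]) (by simpa [hl] using i1))
      (hinv _ _ _ _ hxy' (by simp [hl]) (by simpa [hl] using i2.trans i1))
      (hinv _ _ _ _ (hxy'.trans hxy) (by simp [hl]) (by simpa [hl] using i3))
      (hinv _ _ _ _ hxy (by simp [hl]) (by simpa [hl] using i4.trans i3))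
      (fun i j => hlen _ _ _ _ (by simp [hl]))
    simpa using this
  | u :: v :: c, hl' =>
    simp only [List.cons_append, List.cons.injEq] at hl'
    obtain ⟨rfl, rfl, rfl⟩ := hl'
    have i1 := inversions_swap_lt hxy a (c ++ x' :: y' :: b')
    have i2 := inversions_swap_lt hxy' (a ++ x :: y :: c) b'
    simp only [List.append_assoc, List.cons_append] at i1 i2
    have := confluent_of_disjoint (B := B) (f := f) (a := a) (b := b') (c := c) (x := x) (y := y)
      (x' := x') (y' := y')
      (hinv _ _ _ _ hxy' (by simp [hl]) (by simpa [hl] using i1))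
      (hinv _ _ _ _ hxy (by simp [hl]) (by simpa [hl] using i2))
      (fun i => hlen _ _ _ _ (by simp [hl]))
      (fun i => hlen _ _ _ _ (by simp [hl]))
    simpa using this

lemma slot_append_singleton {l : List ι} {i : ι} (hi : i ∈ H) (a : List ι) (v : L) :
    slot B (straighten B χ H) a (l ++ [i]) v = slot B (straighten B χ H) a l v * χ (B i) := by
  have : slot B (straighten B χ H) a (l ++ [i]) =
      LinearMap.mulRight k (χ (B i)) ∘ₗ slot B (straighten B χ H) a l := by
    refine B.ext fun j => ?_
    have := straighten_append_singleton B χ H hi (a ++ j :: l)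
    simpa [slot_basis] using this
  rw [this]
  rfl

lemma slot_of_mem_span (a : List ι) {v : L} (hv : v ∈ Submodule.span k (B '' H)) :
    slot B (straighten B χ H) a [] v = straighten B χ H a * χ v := by
  have : Submodule.span k (B '' H) ≤ LinearMap.eqLocus (slot B (straighten B χ H) a [])
      (LinearMap.mulLeft k (straighten B χ H a) ∘ₗ χ) := by
    rw [Submodule.span_le]
    rintro _ ⟨i, hi, rfl⟩
    have := straighten_append_singleton B χ H hi a
    simpa [slot_basis] using this
  exact this hv

/-- Induction on the length and then on the number of inversions; by antisymmetry only descents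
matter. A last letter in `H` is treated directly. Otherwise `straighten` used some descent of the
word, and `confluent` compares it with the given one. -/
theorem swapRel_straighten (hH : IsUpperSet H)
    (hspan : ∀ i ∈ H, ∀ j ∈ H, ⁅B i, B j⁆ ∈ Submodule.span k (B '' H))
    (hχ : ∀ i ∈ H, ∀ j ∈ H, χ ⁅B i, B j⁆ = 0) (a : List ι) (x y : ι) (b : List ι) :
    SwapRel B (straighten B χ H) a x y b := by
  suffices key : ∀ n m : ℕ, ∀ a x y b, y < x → (a ++ x :: y :: b).length = n →
      inversions (a ++ x :: y :: b) = m → SwapRel B (straighten B χ H) a x y b by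
    rcases lt_trichotomy x y with h | rfl | h
    · exact (key _ _ a y x b h rfl rfl).symm
    · exact SwapRel.refl _ _ _ _
    · exact key _ _ a x y b h rfl rfl
  intro n
  induction n using Nat.strong_induction_on with
  | _ n ihn =>
  intro m
  induction m using Nat.strong_induction_on with
  | _ m ihm =>
  intro a x y b hxy hn hm
  have hlen : ∀ a' x' y' b', (a' ++ x' :: y' :: b').length < (a ++ x :: y :: b).length →
      SwapRel B (straighten B χ H) a' x' y' b' := by
    intro a' x' y' b' h
    rw [hn] at h
    rcases lt_trichotomy x' y' with h' | rfl | h'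
    · refine (ihn _ h _ a' y' x' b' h' ?_ rfl).symm
      simp
    · exact SwapRel.refl _ _ _ _
    · exact ihn _ h _ a' x' y' b' h' rfl rfl
  have hinv : ∀ a' x' y' b', y' < x' →
      (a' ++ x' :: y' :: b').length = (a ++ x :: y :: b).length →
      inversions (a' ++ x' :: y' :: b') < inversions (a ++ x :: y :: b) →
        SwapRel B (straighten B χ H) a' x' y' b' := by
    intro a' x' y' b' h h1 h2
    exact ihm _ (hm ▸ h2) a' x' y' b' h (h1.trans hn) rfl
  by_cases hend : ∃ l' i, i ∈ H ∧ a ++ x :: y :: b = l' ++ [i]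
  · obtain ⟨l', i, hi, e⟩ := hend
    rcases List.eq_nil_or_concat b with rfl | ⟨b', j, rfl⟩
    · have e' : a ++ [x] = l' ∧ y = i := by
        have : (a ++ [x]) ++ [y] = l' ++ [i] := by simpa using e
        simpa using List.append_inj' this rfl
      obtain ⟨-, rfl⟩ := e'
      -- Since `H` is an upper set, the larger letter `x` also lies in `H`; both orders of `x`, `y`
      -- then give the same product of scalars, and `χ` kills their bracket.
      have hx : x ∈ H := hH hxy.le hi
      have s1 := straighten_append_singleton B χ H hi (a ++ [x])
      have s2 := straighten_append_singleton B χ H hx (a ++ [y])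
      rw [straighten_append_singleton B χ H hx] at s1
      rw [straighten_append_singleton B χ H hi] at s2
      unfold SwapRel
      rw [slot_of_mem_span B a (hspan x hx y hi), hχ x hx y hi]
      simp only [List.append_assoc, List.cons_append, List.nil_append] at s1 s2
      rw [s1, s2]
      ring
    · have e' : j = i := by
        have : (a ++ x :: y :: b') ++ [j] = l' ++ [i] := by simpa using e
        simpa using (List.append_inj' this rfl).2
      subst e'
      have h := hlen a x y b' (by simp)
      unfold SwapRel at h ⊢
      have s1 := straighten_append_singleton B χ H hi (a ++ x :: y :: b')
      have s2 := straighten_append_singleton B χ H hi (a ++ y :: x :: b')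
      have s3 := slot_append_singleton (χ := χ) (l := b') B hi a ⁅B x, B y⁆
      simp only [List.append_assoc, List.cons_append, List.concat_eq_append]
        at s1 s2 s3 ⊢
      rw [s1, s2, s3, h]
      ring
  · push Not at hend
    obtain ⟨a', x', y', b', hxy', e, h⟩ := exists_swapRel (χ := χ) B hend ⟨a, x, y, b, hxy, rfl⟩
    unfold SwapRel at h ⊢
    rw [e, h]
    -- One of the two prefixes extends the other, which tells which descent comes first.
    rcases List.append_eq_append_iff.1 e with ⟨c, hc, -⟩ | ⟨c, hc, -⟩
    · exact (confluent B hlen hinv hxy rfl hxy' e c hc).symm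
    · exact confluent B (l := a ++ x :: y :: b) hlen hinv hxy' e hxy rfl c hc

end Straightening

/-! ### The coinduced module -/

section Coinduced

variable {k : Type*} [CommRing k] {L : Type*} [LieRing L] [LieAlgebra k L]
variable {ι : Type*} (B : Module.Basis ι k L)
variable (R : Type*) [CommRing R] [Algebra k R]

variable {R} in
lemma slot_add (f f' : List ι → R) (a b : List ι) :
    slot B (f + f') a b = slot B f a b + slot B f' a b :=
  B.ext fun i => by simp [slot_basis]

variable {R} in
lemma slot_smul (r : R) (f : List ι → R) (a b : List ι) :
    slot B (r • f) a b = r • slot B f a b :=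
  B.ext fun i => by simp [slot_basis]

/-- The functions on words that are compatible with the relations of the enveloping algebra. -/
def coinduced : Submodule R (List ι → R) where
  carrier := {f | ∀ a x y b, SwapRel B f a x y b}
  zero_mem' a x y b := by
    have : slot B (0 : List ι → R) a b = 0 := B.ext fun i => by simp [slot_basis]
    simp [SwapRel, this]
  add_mem' {f f'} hf hf' a x y b := by
    have h := hf a x y b
    have h' := hf' a x y b
    unfold SwapRel at *
    rw [Pi.add_apply, h, h', slot_add, LinearMap.add_apply, Pi.add_apply]
    ring
  smul_mem' r f hf a x y b := by
    have h := hf a x y b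
    unfold SwapRel at *
    rw [Pi.smul_apply, h, slot_smul, LinearMap.smul_apply, Pi.smul_apply, smul_add]

/-- A basis element acts on functions on words by translation. -/
def coinducedShift (i : ι) : Module.End k (coinduced B R) where
  toFun f := ⟨fun l => f.1 (l ++ [i]), fun a x y b => by
    have h := f.2 a x y (b ++ [i])
    have e : slot B (fun l => f.1 (l ++ [i])) a b = slot B f.1 a (b ++ [i]) :=
      B.ext fun j => by simp [slot_basis]
    unfold SwapRel at *
    rw [e]
    simpa using h⟩
  map_add' _ _ := rfl
  map_smul' _ _ := rfl

/-- The action of the Lie algebra on functions on words, as a linear map. -/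
def coinducedAction : L →ₗ[k] Module.End k (coinduced B R) :=
  B.constr k (coinducedShift B R)

lemma coinducedAction_apply (v : L) (f : coinduced B R) (l : List ι) :
    (coinducedAction B R v f).1 l = slot B f.1 l [] v := by
  have : (LinearMap.proj l ∘ₗ (coinduced B R).subtype.restrictScalars k) ∘ₗ
      (coinducedAction B R).flip f = slot B f.1 l [] := by
    refine B.ext fun i => ?_
    simp [coinducedAction, slot_basis, coinducedShift]
  exact LinearMap.congr_fun this v

/-- The action of the Lie algebra on functions on words. -/
def coinducedRep : L →ₗ⁅k⁆ Module.End k (coinduced B R) where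
  __ := coinducedAction B R
  map_lie' {x y} := by
    let A := coinducedAction B R
    let M : L →ₗ[k] L →ₗ[k] Module.End k (coinduced B R) :=
      (LinearMap.mul k (Module.End k (coinduced B R))).compl₁₂ A A
    -- On basis vectors this is the swap relation at the end of a word.
    have h : (LieModule.toEnd k L L : L →ₗ[k] Module.End k L).compr₂ A + M.flip = M := by
      refine B.ext fun i => B.ext fun j => LinearMap.ext fun f => Subtype.ext (funext fun l => ?_)
      have h := f.2 l i j []
      unfold SwapRel at h
      change (coinducedAction B R ⁅B i, B j⁆ f).1 l +
          (coinducedAction B R (B j) (coinducedAction B R (B i) f)).1 l =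
        (coinducedAction B R (B i) (coinducedAction B R (B j) f)).1 l
      simp only [coinducedAction_apply, slot_basis, List.append_assoc, List.cons_append,
        List.nil_append]
      rw [h, add_comm]
    exact eq_sub_of_add_eq (LinearMap.congr_fun (LinearMap.congr_fun h x) y)

instance : LieRingModule L (coinduced B R) :=
  LieRingModule.compLieHom (coinduced B R) (coinducedRep B R)

instance : LieModule k L (coinduced B R) :=
  LieModule.compLieHom (coinduced B R) (coinducedRep B R)

variable {R}

lemma coinduced_lie_apply (v : L) (f : coinduced B R) (l : List ι) :
    (⁅v, f⁆ : coinduced B R).1 l = slot B f.1 l [] v :=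
  coinducedAction_apply B R v f l

lemma coinduced_lie_smul (v : L) (r : R) (f : coinduced B R) : ⁅v, r • f⁆ = r • ⁅v, f⁆ := by
  refine Subtype.ext (funext fun l => ?_)
  rw [coinduced_lie_apply]
  change slot B (r • f.1) l [] v = r • (⁅v, f⁆ : coinduced B R).1 l
  rw [slot_smul, coinduced_lie_apply]
  rfl

/-- A linear form `χ` on a Lie algebra `L` which is a character on the span of the basis elements
with indices in an upper set `H` occurs in some `L`-module. -/
theorem exists_coinduced_eigenvector [LinearOrder ι] {χ : L →ₗ[k] R} {H : Set ι}
    (hH : IsUpperSet H)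
    (hspan : ∀ i ∈ H, ∀ j ∈ H, ⁅B i, B j⁆ ∈ Submodule.span k (B '' H))
    (hχ : ∀ i ∈ H, ∀ j ∈ H, χ ⁅B i, B j⁆ = 0) :
    ∃ f : coinduced B R, f.1 [] = 1 ∧
      ∀ v ∈ Submodule.span k (B '' H), ⁅v, f⁆ = χ v • f := by
  refine ⟨⟨straighten B χ H, swapRel_straighten B hH hspan hχ⟩, straighten_nil B χ H,
    fun v hv => Subtype.ext (funext fun l => ?_)⟩
  rw [coinduced_lie_apply, slot_of_mem_span B l hv, mul_comm]
  rfl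

end Coinduced

/-! ### Ordered bases adapted to a subspace -/

section OrderedBasis

variable {k : Type*} [Field k] {E : Type u} [AddCommGroup E] [Module k E]

/-- Every subspace is spanned by an upper segment of an ordered basis. -/
lemma exists_basis_isUpperSet (h : Submodule k E) :
    ∃ (ι : Type u) (_ : LinearOrder ι) (B : Module.Basis ι k E) (H : Set ι),
      IsUpperSet H ∧ Submodule.span k (B '' H) = h := by
  classical
  obtain ⟨s, hsh, hs, hli⟩ := exists_linearIndependent k (h : Set E)
  let t := LinearIndepOn.extend (v := id) hli (Set.subset_univ s)
  have hst : s ⊆ t := LinearIndepOn.subset_extend _ _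
  let B : Module.Basis t k E := Module.Basis.extend hli
  let _ : LinearOrder t := linearOrderOfSTO WellOrderingRel
  -- Membership in `s` is compared first and `true` is the larger value, so `s` becomes an upper
  -- segment; the well-ordering only breaks ties.
  let e : t → Bool ×ₗ t := fun x => toLex (decide ((x : E) ∈ s), x)
  have he : Function.Injective e := fun x y hxy => congrArg (fun z => (ofLex z).2) hxy
  refine ⟨t, LinearOrder.lift' e he, B, {x | (x : E) ∈ s}, ?_, ?_⟩
  · intro x y hxy hx
    have h' : e x ≤ e y := hxy
    rcases Prod.Lex.le_iff.1 h' with h' | h'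
    · simp only [e, ofLex_toLex] at h'
      have hx' : decide ((x : E) ∈ s) = true := decide_eq_true hx
      rw [hx'] at h'
      exact absurd h' (not_lt_of_ge le_top)
    · exact of_decide_eq_true (h'.1.symm.trans (decide_eq_true hx))
  · have : B '' {x | (x : E) ∈ s} = s := by
      ext x
      constructor
      · rintro ⟨y, hy, rfl⟩
        rw [show B y = y from Module.Basis.extend_apply_self hli y]
        exact hy
      · intro hx
        exact ⟨⟨x, hst hx⟩, hx, Module.Basis.extend_apply_self _ _⟩
    rw [this, hs, Submodule.span_eq]

end OrderedBasis

/-! ### The splitting of `𝔤` into `𝔫` and `𝔟₋` -/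

section Decomposition

variable {Q : Type v} [AddCommGroup Q] [LinearOrder Q]
variable {g : Type u} [LieRing g] [LieAlgebra ℂ g]
variable (𝔤 : Q → Submodule ℂ g) [GradedLieAlgebra 𝔤] (π : Q →+o ℤ)

lemma decompose_eq_zero_of_mem_partSum {P : ℤ → Prop} {x : g} (hx : x ∈ partSum 𝔤 π P) {α : Q}
    (hα : ¬ P (π α)) : (DirectSum.decompose 𝔤 x α : g) = 0 := by
  have : partSum 𝔤 π P ≤ LinearMap.ker
      (DirectSum.component ℂ Q (fun i => 𝔤 i) α ∘ₗ (DirectSum.decomposeLinearEquiv 𝔤).toLinearMap) :=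
    partSum_le fun β hβ y hy =>
      Subtype.ext (DirectSum.decompose_of_mem_ne 𝔤 hy (by rintro rfl; exact hα hβ))
  exact congrArg Subtype.val (this hx)

lemma isCompl_nPos_bNeg : IsCompl (nPos 𝔤 π).toSubmodule (bNeg 𝔤 π).toSubmodule := by
  constructor
  · rw [Submodule.disjoint_def]
    intro x hx hx'
    apply (DirectSum.decompose 𝔤).injective
    rw [DirectSum.decompose_zero]
    refine DFinsupp.ext fun α => Subtype.ext ?_
    by_cases hα : 0 < π α
    · exact decompose_eq_zero_of_mem_partSum 𝔤 π hx' (not_le.2 hα)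
    · exact decompose_eq_zero_of_mem_partSum 𝔤 π hx hα
  · rw [codisjoint_iff, eq_top_iff, ← (DirectSum.Decomposition.isInternal 𝔤).submodule_iSup_eq_top]
    refine iSup_le fun α x hx => ?_
    by_cases hα : 0 < π α
    · exact Submodule.mem_sup_left (mem_partSum (P := fun m => 0 < m) hα hx)
    · exact Submodule.mem_sup_right (mem_partSum (P := fun m => m ≤ 0) (not_lt.1 hα) hx)

end Decomposition

/-! ### Universal properties of `M_φ` and `M_φ / I M_φ` -/

section Universal

variable {Q : Type v} [AddCommGroup Q] [LinearOrder Q]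
variable {g : Type u} [LieRing g] [LieAlgebra ℂ g]
variable {𝔤 : Q → Submodule ℂ g} [SetLike.GradedBracket 𝔤] {π : Q →+o ℤ}
variable {φ : nPos 𝔤 π →ₗ⁅ℂ⁆ ℂ}
variable {V : Type w} [AddCommGroup V] [Module ℂ V] [LieRingModule g V] [LieModule ℂ g V]

lemma envAction_ι (x : g) (v : V) :
    envAction g V (UniversalEnvelopingAlgebra.ι ℂ x) v = ⁅x, v⁆ := by
  rw [envAction, UniversalEnvelopingAlgebra.lift_ι_apply]
  rfl

lemma envAction_envIncl {v : V} (hv : IsWhittakerVector φ v) (n : Env (nPos 𝔤 π)) :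
    envAction g V (envIncl 𝔤 π n) v = charEnv φ n • v := by
  let S : Subalgebra ℂ (Env (nPos 𝔤 π)) :=
    { carrier := {n | envAction g V (envIncl 𝔤 π n) v = charEnv φ n • v}
      mul_mem' := fun {a b} ha hb => by
        change _ = _ at ha
        change _ = _ at hb
        change _ = _
        rw [map_mul, map_mul, Module.End.mul_apply, hb, map_smul, ha, map_mul, mul_comm, mul_smul]
      add_mem' := fun {a b} ha hb => by
        change _ = _ at ha
        change _ = _ at hb
        change _ = _
        rw [map_add, map_add, LinearMap.add_apply, ha, hb, map_add, add_smul]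
      algebraMap_mem' := fun c => by
        change _ = _
        rw [AlgHom.commutes, AlgHom.commutes, AlgHom.commutes, Module.algebraMap_end_apply]
        rfl }
  refine mem_of_ι_mem S (fun x => ?_) n
  change _ = _
  rw [envIncl, charEnv, UniversalEnvelopingAlgebra.lift_ι_apply,
    UniversalEnvelopingAlgebra.lift_ι_apply]
  exact (envAction_ι (x : g) v).trans (hv x)

/-- The universal property of `M_φ`. -/
theorem exists_lieModuleHom_of_isWhittakerVector {v : V} (hv : IsWhittakerVector φ v) :
    ∃ F : Mφ φ →ₗ⁅ℂ,g⁆ V, F (wφ φ) = v := by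
  let _ : Module (Env g) V := Module.compHom V (envAction g V).toRingHom
  have hsmul : ∀ (a : Env g) (x : V), a • x = envAction g V a x := fun _ _ => rfl
  have : IsScalarTower ℂ (Env g) V := ⟨fun c a x => by
    rw [hsmul, hsmul, map_smul, LinearMap.smul_apply]⟩
  let T : Env g ⊗[ℂ] ℂ →ₗ[Env g] V :=
    (LinearMap.toSpanSingleton (Env g) V v) ∘ₗ
      (TensorProduct.AlgebraTensorModule.rid ℂ (Env g) (Env g)).toLinearMap
  have hT : ∀ (u : Env g) (c : ℂ), T (u ⊗ₜ c) = c • envAction g V u v := fun u c => by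
    simp [T, hsmul]
  have hker : balancedRel φ ≤ LinearMap.ker T := by
    refine Submodule.span_le.2 ?_
    rintro _ ⟨u, n, c, rfl⟩
    rw [SetLike.mem_coe, LinearMap.mem_ker, map_sub, hT, hT, map_mul, Module.End.mul_apply,
      envAction_envIncl hv, map_smul, smul_smul, mul_comm, sub_self]
  let F : Mφ φ →ₗ[Env g] V := (balancedRel φ).liftQ T hker
  refine ⟨{ toFun := F
            map_add' := map_add F
            map_smul' := fun c m => ?_
            map_lie' := fun {x m} => ?_ }, ?_⟩
  · change F (c • m) = c • F m
    rw [← algebraMap_smul (Env g) c m, map_smul, algebraMap_smul]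
  · change F (UniversalEnvelopingAlgebra.ι ℂ x • m) = _
    rw [map_smul, hsmul, envAction_ι]
  · change T ((1 : Env g) ⊗ₜ (1 : ℂ)) = v
    rw [hT, map_one, one_smul, Module.End.one_apply]

lemma SZToEnv_ι (z : centerNeg 𝔤 π) :
    SZToEnv 𝔤 π (SymmetricAlgebra.ι ℂ _ z) = UniversalEnvelopingAlgebra.ι ℂ (z : g) := by
  change (SymmetricAlgebra.lift (centerNegToEnv 𝔤 π) (SymmetricAlgebra.ι ℂ _ z) : Env g) = _
  rw [SymmetricAlgebra.lift_ι_apply]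
  rfl

/-- The action of `S(Z'')` on a module commutes with the enveloping algebra. -/
lemma SZToEnv_mul_comm (p : SZ 𝔤 π) (a : Env g) : SZToEnv 𝔤 π p * a = a * SZToEnv 𝔤 π p :=
  (Subalgebra.mem_center_iff.1 (SymmetricAlgebra.lift (centerNegToEnv 𝔤 π) p).2 a).symm

lemma envAction_SZToEnv_comm (p : SZ 𝔤 π) (a : Env g) (v : V) :
    envAction g V (SZToEnv 𝔤 π p) (envAction g V a v) =
      envAction g V a (envAction g V (SZToEnv 𝔤 π p) v) := by
  rw [← Module.End.mul_apply, ← map_mul, SZToEnv_mul_comm, map_mul, Module.End.mul_apply]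

/-- An element of `S(Z'')` that kills the image of a generator kills the image of the module. -/
lemma envAction_SZToEnv_eq_zero {M : Type w'} [AddCommGroup M] [Module ℂ M] [LieRingModule g M]
    [LieModule ℂ g M] {w : M} (hw : LieSubmodule.lieSpan ℂ g {w} = ⊤) (F : M →ₗ⁅ℂ,g⁆ V)
    {p : SZ 𝔤 π} (hp : envAction g V (SZToEnv 𝔤 π p) (F w) = 0) (m : M) :
    envAction g V (SZToEnv 𝔤 π p) (F m) = 0 := by
  let N : LieSubmodule ℂ g M :=
    { LinearMap.ker (envAction g V (SZToEnv 𝔤 π p) ∘ₗ (F : M →ₗ[ℂ] V)) with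
      lie_mem := fun {x m} hm => by
        change envAction g V (SZToEnv 𝔤 π p) (F m) = 0 at hm
        change envAction g V (SZToEnv 𝔤 π p) (F ⁅x, m⁆) = 0
        rw [LieModuleHom.map_lie, ← envAction_ι, envAction_SZToEnv_comm, hm, map_zero] }
  have hN : (⊤ : LieSubmodule ℂ g M) ≤ N := by
    rw [← hw, LieSubmodule.lieSpan_le]
    rintro _ rfl
    exact hp
  exact hN (LieSubmodule.mem_top m)

lemma mem_annIdeal_of_generator {v : V} (hv : LieSubmodule.lieSpan ℂ g {v} = ⊤) {p : SZ 𝔤 π} :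
    p ∈ annIdeal 𝔤 π V ↔ envAction g V (SZToEnv 𝔤 π p) v = 0 :=
  ⟨fun h => LinearMap.congr_fun (show envAction g V (SZToEnv 𝔤 π p) = 0 from h) v,
    fun h => LinearMap.ext fun m => envAction_SZToEnv_eq_zero hv LieModuleHom.id h m⟩

lemma lieSpan_mk_wφ (I : Ideal (SZ 𝔤 π)) :
    LieSubmodule.lieSpan ℂ g {LieSubmodule.Quotient.mk' (idealMul φ I) (wφ φ)} = ⊤ := by
  let p := LieSubmodule.Quotient.mk' (idealMul φ I)
  set N := LieSubmodule.lieSpan ℂ g {p (wφ φ)}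
  have h : (⊤ : LieSubmodule ℂ g (Mφ φ)) ≤ N.comap p := by
    rw [← lieSpan_wφ, LieSubmodule.lieSpan_le]
    rintro _ rfl
    exact LieSubmodule.subset_lieSpan rfl
  refine eq_top_iff.2 fun v _ => ?_
  obtain ⟨m, rfl⟩ := LieSubmodule.Quotient.surjective_mk' (idealMul φ I) v
  exact h (LieSubmodule.mem_top m)

lemma le_annIdeal_Lφ (I : Ideal (SZ 𝔤 π)) : I ≤ annIdeal 𝔤 π (Lφ φ I) := by
  intro p hp
  rw [mem_annIdeal_of_generator (lieSpan_mk_wφ I), ← envAction_map, envAction_Mφ,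
    LieSubmodule.Quotient.mk_eq_zero]
  exact LieSubmodule.subset_lieSpan ⟨p, hp, _, rfl⟩

/-- The universal property of `M_φ / I M_φ`: a homomorphism from `M_φ` kills `I M_φ` as soon as
`I` kills the image of the generator. -/
lemma idealMul_le_ker {I : Ideal (SZ 𝔤 π)} (F : Mφ φ →ₗ⁅ℂ,g⁆ V)
    (hI : ∀ p ∈ I, envAction g V (SZToEnv 𝔤 π p) (F (wφ φ)) = 0) :
    idealMul φ I ≤ F.ker := by
  refine LieSubmodule.lieSpan_le.2 ?_
  rintro _ ⟨p, hp, m, rfl⟩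
  change F _ = 0
  rw [← envAction_Mφ, envAction_map]
  exact envAction_SZToEnv_eq_zero (lieSpan_wφ φ) F (hI p hp) m

end Universal

/-! ### The annihilator of `M_φ / I M_φ` -/

section RightInverse

variable {Q : Type v} [AddCommGroup Q] [LinearOrder Q]
variable {g : Type u} [LieRing g] [LieAlgebra ℂ g]
variable {𝔤 : Q → Submodule ℂ g} [GradedLieAlgebra 𝔤] {π : Q →+o ℤ}

/-- The character `(φ, ζ)` of `𝔫 ⊕ Z''`, extended to a linear form on `𝔤`. -/
lemma exists_linearMap_nPos_centerNeg (φ : nPos 𝔤 π →ₗ⁅ℂ⁆ ℂ) {R : Type*} [CommRing R] [Algebra ℂ R]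
    (ζ : centerNeg 𝔤 π →ₗ[ℂ] R) :
    ∃ χ : g →ₗ[ℂ] R, (∀ x : nPos 𝔤 π, χ x = algebraMap ℂ R (φ x)) ∧
      ∀ z : centerNeg 𝔤 π, χ z = ζ z := by
  have hc := isCompl_nPos_bNeg 𝔤 π
  obtain ⟨ψ, hψ⟩ := LinearMap.exists_extend ζ
  refine ⟨Algebra.linearMap ℂ R ∘ₗ (φ : nPos 𝔤 π →ₗ[ℂ] ℂ) ∘ₗ Submodule.projectionOnto _ _ hc +
    ψ ∘ₗ (bNeg 𝔤 π).toSubmodule.subtype ∘ₗ Submodule.projectionOnto _ _ hc.symm, ?_, ?_⟩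
  · intro x
    have h1 := Submodule.projectionOnto_apply_left hc x
    have h2 := Submodule.projectionOnto_apply_right hc.symm x
    simp only [LinearMap.add_apply, LinearMap.comp_apply]
    rw [h1, h2]
    simp
  · intro z
    have h1 := Submodule.projectionOnto_apply_left hc.symm ⟨z, z.2.2⟩
    have h2 := Submodule.projectionOnto_apply_right hc ⟨z, z.2.2⟩
    simp only [LinearMap.add_apply, LinearMap.comp_apply]
    rw [h1, h2]
    simpa using LinearMap.congr_fun hψ z

/-- `Z''` is central, so a bracket sees only the components in `𝔫`. Hence `𝔫 + Z''` is a subalgebra,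
and a linear form extending `φ` kills its brackets. -/
lemma lie_mem_of_mem_sup {x y : g} (hx : x ∈ (nPos 𝔤 π).toSubmodule ⊔ centerNeg 𝔤 π)
    (hy : y ∈ (nPos 𝔤 π).toSubmodule ⊔ centerNeg 𝔤 π) :
    ∃ x' y' : nPos 𝔤 π, ⁅x, y⁆ = (⁅x', y'⁆ : nPos 𝔤 π) := by
  obtain ⟨x', hx', z, hz, rfl⟩ := Submodule.mem_sup.1 hx
  obtain ⟨y', hy', z', hz', rfl⟩ := Submodule.mem_sup.1 hy
  have h1 : ∀ a : g, ⁅a, z'⁆ = 0 := (LieModule.mem_maxTrivSubmodule ℂ g g z').1 hz'.1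
  have h2 : ∀ a : g, ⁅z, a⁆ = 0 := fun a => by
    rw [← lie_skew, (LieModule.mem_maxTrivSubmodule ℂ g g z).1 hz.1, neg_zero]
  refine ⟨⟨x', hx'⟩, ⟨y', hy'⟩, ?_⟩
  rw [add_lie, lie_add, h1, h2, add_zero, add_zero]
  rfl

/-- For every algebra `R` over `S(Z'')`, there is an `R`-linear `𝔤`-module with a Whittaker vector
on which `S(Z'')` acts through `R`, and such that `R` acts freely on this vector. -/
lemma exists_whittakerVector_coinduced (φ : nPos 𝔤 π →ₗ⁅ℂ⁆ ℂ) {R : Type*} [CommRing R]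
    [Algebra ℂ R] (q : SZ 𝔤 π →ₐ[ℂ] R) :
    ∃ (ι : Type u) (B : Module.Basis ι ℂ g) (f : coinduced B R), f.1 [] = 1 ∧
      IsWhittakerVector φ f ∧
      ∀ p : SZ 𝔤 π, envAction g (coinduced B R) (SZToEnv 𝔤 π p) f = q p • f := by
  obtain ⟨χ, hχn, hχz⟩ := exists_linearMap_nPos_centerNeg φ
    (q.toLinearMap ∘ₗ SymmetricAlgebra.ι ℂ (centerNeg 𝔤 π))
  obtain ⟨ι, _, B, H, hH, hBH⟩ :=
    exists_basis_isUpperSet ((nPos 𝔤 π).toSubmodule ⊔ centerNeg 𝔤 π)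
  have hmem : ∀ i ∈ H, B i ∈ (nPos 𝔤 π).toSubmodule ⊔ centerNeg 𝔤 π := fun i hi =>
    hBH ▸ Submodule.subset_span ⟨i, hi, rfl⟩
  obtain ⟨f, hf1, hf⟩ := exists_coinduced_eigenvector B (χ := χ) hH
    (fun i hi j hj => by
      obtain ⟨x, y, h⟩ := lie_mem_of_mem_sup (hmem i hi) (hmem j hj)
      rw [hBH, h]
      exact Submodule.mem_sup_left (Subtype.coe_prop _))
    (fun i hi j hj => by
      obtain ⟨x, y, h⟩ := lie_mem_of_mem_sup (hmem i hi) (hmem j hj)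
      rw [h, hχn, LieHom.map_lie, LieRing.of_associative_ring_bracket, mul_comm, sub_self,
        map_zero])
  rw [hBH] at hf
  -- The factor `r` is needed for the induction: in a product, the second factor acts on a multiple
  -- of `f`.
  have hp : ∀ (p : SZ 𝔤 π) (r : R), envAction g (coinduced B R) (SZToEnv 𝔤 π p) (r • f) =
      (q p * r) • f := by
    intro p
    induction p using SymmetricAlgebra.induction with
    | algebraMap c =>
      intro r
      rw [AlgHom.commutes, AlgHom.commutes, AlgHom.commutes, Module.algebraMap_end_apply, mul_smul,
        algebraMap_smul]
    | ι z =>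
      intro r
      rw [SZToEnv_ι, envAction_ι, coinduced_lie_smul, hf z (Submodule.mem_sup_right z.2), hχz,
        mul_comm, mul_smul]
      rfl
    | mul a b ha hb =>
      intro r
      rw [map_mul, map_mul, Module.End.mul_apply, hb, ha, map_mul, mul_assoc]
    | add a b ha hb =>
      intro r
      rw [map_add, map_add, LinearMap.add_apply, ha, hb, map_add, add_mul, add_smul]
  refine ⟨ι, B, f, hf1, fun x => ?_, fun p => ?_⟩
  · rw [hf x (Submodule.mem_sup_left x.2), hχn, algebraMap_smul]
  · have h := hp p 1
    rwa [one_smul, mul_one] at h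

/-- The map from `M_φ` to the coinduced module sending the generator to `f` kills `(ker q) M_φ`. If
`p` kills the quotient, then `q(p) f = 0`, and evaluation at the empty word gives `q(p) = 0`. -/
lemma annIdeal_Lφ_ker_le (φ : nPos 𝔤 π →ₗ⁅ℂ⁆ ℂ) {R : Type*} [CommRing R] [Algebra ℂ R]
    (q : SZ 𝔤 π →ₐ[ℂ] R) : annIdeal 𝔤 π (Lφ φ (RingHom.ker q)) ≤ RingHom.ker q := by
  obtain ⟨ι, B, f, hf1, hw, hp⟩ := exists_whittakerVector_coinduced φ q
  obtain ⟨F, hF⟩ := exists_lieModuleHom_of_isWhittakerVector hw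
  have hker : idealMul φ (RingHom.ker q) ≤ F.ker := idealMul_le_ker F (fun p hpI => by
    rw [hF, hp, (RingHom.mem_ker).1 hpI, zero_smul])
  intro p hpL
  rw [mem_annIdeal_of_generator (lieSpan_mk_wφ _), ← envAction_map,
    LieSubmodule.Quotient.mk_eq_zero] at hpL
  have h0 : F (envAction g (Mφ φ) (SZToEnv 𝔤 π p) (wφ φ)) = 0 := hker hpL
  rw [envAction_map, hF, hp] at h0
  have h1 : q p * f.1 [] = 0 := congrFun (congrArg Subtype.val h0) []
  rwa [hf1, mul_one] at h1

theorem annIdeal_Lφ (φ : nPos 𝔤 π →ₗ⁅ℂ⁆ ℂ) (I : Ideal (SZ 𝔤 π)) :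
    annIdeal 𝔤 π (Lφ φ I) = I := by
  -- The ideal occurs in the type `Lφ φ J`, so the equality of `I` with the kernel of the quotient
  -- map is used by substituting a variable.
  have h (J : Ideal (SZ 𝔤 π)) (hJ : J = I) (hle : annIdeal 𝔤 π (Lφ φ J) ≤ J) :
      annIdeal 𝔤 π (Lφ φ I) ≤ I := by
    subst hJ
    exact hle
  exact le_antisymm (h _ (Ideal.Quotient.mkₐ_ker ℂ I)
    (annIdeal_Lφ_ker_le φ (Ideal.Quotient.mkₐ ℂ I))) (le_annIdeal_Lφ I)

end RightInverse

/-! ### Generators of `𝔟₋` modulo `Z''` and the weight filtration -/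

section Frame

variable {Q : Type v} [AddCommGroup Q] [LinearOrder Q]
variable {g : Type u} [LieRing g] [LieAlgebra ℂ g]
variable {𝔤 : Q → Submodule ℂ g} [SetLike.GradedBracket 𝔤] {π : Q →+o ℤ}

/-- Homogeneous elements of `𝔟₋` which span it modulo `Z''`, together with the properties of the
leading degree of `φ` that are used to separate them. -/
structure NegFrame (φ : nPos 𝔤 π →ₗ⁅ℂ⁆ ℂ) where
  /-- The leading degree `α_φ` of `φ`. -/
  top : Q
  /-- The degrees of the noncentral elements of `𝔟₋`. -/
  J : Set Q
  /-- The spanning elements. -/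
  x : J → g
  top_pos : 0 < π top
  apply_eq_zero : ∀ α, top < α → ∀ y : nPos 𝔤 π, (y : g) ∈ 𝔤 α → φ y = 0
  deg_nonpos : ∀ β : J, π β ≤ 0
  x_mem : ∀ β : J, x β ∈ 𝔤 β
  span : ∀ β, π β ≤ 0 → ∀ y ∈ 𝔤 β, ∃ z ∈ centerNeg 𝔤 π,
    y = z ∨ ∃ (j : J) (c : ℂ), (j : Q) = β ∧ y = c • x j + z
  pairing : ∀ β : J, ∃ y ∈ 𝔤 (top - β), ∃ h : ⁅y, x β⁆ ∈ nPos 𝔤 π, φ ⟨⁅y, x β⁆, h⟩ ≠ 0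

/-- Any noncentral element of `𝔤_β` serves as `x_β`: the image of `𝔤_β` modulo the center is at most
a line, so `x_β` spans it, and the pairing is nonsingularity at `x_β`. -/
lemma exists_negFrame (hgood : IsQGood 𝔤 π) {φ : nPos 𝔤 π →ₗ⁅ℂ⁆ ℂ} (hns : IsNonsingular 𝔤 π φ) :
    Nonempty (NegFrame φ) := by
  obtain ⟨t, ht, hpair⟩ := hns
  let J : Set Q := {β | π β ≤ 0 ∧ ∃ x ∈ 𝔤 β, x ∉ LieAlgebra.center ℂ g}
  choose x hx hx' using fun β : J => β.2.2
  refine ⟨⟨t, J, x, ht.1.1, fun α hα y hy => ?_, fun β => β.2.1, hx, fun β hβ y hy => ?_,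
    fun β => hpair β β.2.1 (x β) (hx β) (hx' β)⟩⟩
  · by_contra h0
    have hπ : 0 < π α := ht.1.1.trans_le (OrderHomClass.mono π hα.le)
    exact absurd (ht.2 ⟨hπ, y, hy, h0⟩ hα.le) (not_le_of_gt hα)
  · have hneg : ∀ {a : g}, a ∈ 𝔤 β → a ∈ (bNeg 𝔤 π).toSubmodule := fun ha =>
      mem_partSum (P := fun m => m ≤ 0) hβ ha
    by_cases hJ : β ∈ J
    · obtain ⟨v₀, -, hv₀⟩ := (rank_submodule_le_one_iff _).1 (hgood.rank_nonpos β hβ)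
      have hmem : ∀ {a : g}, a ∈ 𝔤 β → ∃ r : ℂ,
          r • v₀ = (LieAlgebra.center ℂ g).toSubmodule.mkQ a := fun ha =>
        Submodule.mem_span_singleton.1 (hv₀ (Submodule.mem_map_of_mem ha))
      obtain ⟨r, hr⟩ := hmem (hx ⟨β, hJ⟩)
      obtain ⟨s, hs⟩ := hmem hy
      have hr0 : r ≠ 0 := by
        rintro rfl
        rw [zero_smul] at hr
        exact hx' ⟨β, hJ⟩ ((Submodule.Quotient.mk_eq_zero _).1 hr.symm)
      refine ⟨y - (s / r) • x ⟨β, hJ⟩, ⟨?_, hneg (sub_mem hy (Submodule.smul_mem _ _ (hx ⟨β, hJ⟩)))⟩,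
        Or.inr ⟨⟨β, hJ⟩, s / r, rfl, by abel⟩⟩
      have : (LieAlgebra.center ℂ g).toSubmodule.mkQ (y - (s / r) • x ⟨β, hJ⟩) = 0 := by
        rw [map_sub, map_smul, ← hr, ← hs, smul_smul, div_mul_cancel₀ _ hr0, sub_self]
      exact (Submodule.Quotient.mk_eq_zero _).1 this
    · refine ⟨y, ⟨?_, hneg hy⟩, Or.inl rfl⟩
      by_contra hy'
      exact hJ ⟨hβ, y, hy, hy'⟩

/-- `𝔤` acts on the `S`-module `V` by `S`-linear maps, and `Z''` acts by scalars. -/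
structure IsCentralAction (𝔤 : Q → Submodule ℂ g) [SetLike.GradedBracket 𝔤] (π : Q →+o ℤ)
    (S : Type*) [CommRing S] (V : Type*) [AddCommGroup V] [Module ℂ V] [Module S V]
    [LieRingModule g V] : Prop where
  lie_smul : ∀ (a : g) (s : S) (v : V), ⁅a, s • v⁆ = s • ⁅a, v⁆
  lie_center : ∀ z ∈ centerNeg 𝔤 π, ∃ s : S, ∀ v : V, ⁅z, v⁆ = s • v

namespace NegFrame

variable {φ : nPos 𝔤 π →ₗ⁅ℂ⁆ ℂ} (D : NegFrame φ)

/-- The weight of a word. -/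
def wt (l : List D.J) : ℤ := (l.map fun β : D.J => π D.top - π (β : Q)).sum

@[simp] lemma wt_nil : D.wt [] = 0 := rfl

@[simp] lemma wt_cons (β : D.J) (l : List D.J) :
    D.wt (β :: l) = π D.top - π β + D.wt l := by
  simp [wt]

lemma wt_perm {l l' : List D.J} (h : l.Perm l') : D.wt l = D.wt l' :=
  (h.map fun β : D.J => π D.top - π (β : Q)).sum_eq

variable {V : Type w} [AddCommGroup V] [LieRingModule g V]

/-- The vector obtained by applying a word to `v`. -/
def wordVec (v : V) (l : List D.J) : V := l.foldr (fun β u => ⁅D.x β, u⁆) v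

@[simp] lemma wordVec_nil (v : V) : D.wordVec v [] = v := rfl

@[simp] lemma wordVec_cons (v : V) (β : D.J) (l : List D.J) :
    D.wordVec v (β :: l) = ⁅D.x β, D.wordVec v l⁆ := rfl

variable (S : Type w') [CommRing S] [Module S V]

/-- The filtration by weight. -/
def fil (v : V) (d : ℤ) : Submodule S V :=
  Submodule.span S {u | ∃ l, D.wt l ≤ d ∧ u = D.wordVec v l}

variable {S} {v : V}

lemma wordVec_mem_fil {l : List D.J} {d : ℤ} (h : D.wt l ≤ d) : D.wordVec v l ∈ D.fil S v d :=
  Submodule.subset_span ⟨l, h, rfl⟩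

lemma fil_mono {d e : ℤ} (h : d ≤ e) : D.fil S v d ≤ D.fil S v e :=
  Submodule.span_mono fun _ ⟨l, hl, hu⟩ => ⟨l, hl.trans h, hu⟩

lemma mem_fil_of_le {d e : ℤ} (h : d ≤ e) {u : V} (hu : u ∈ D.fil S v d) : u ∈ D.fil S v e :=
  D.fil_mono h hu

variable [Algebra ℂ S] [Module ℂ V] [IsScalarTower ℂ S V] [LieModule ℂ g V]
variable (hS : IsCentralAction 𝔤 π S V)
include hS

omit [Algebra ℂ S] [IsScalarTower ℂ S V] [LieModule ℂ g V] in
lemma lie_x_mem_fil (β : D.J) {d : ℤ} {u : V} (hu : u ∈ D.fil S v d) :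
    ⁅D.x β, u⁆ ∈ D.fil S v (d + (π D.top - π β)) := by
  induction hu using Submodule.span_induction with
  | mem u h =>
    obtain ⟨l, hl, rfl⟩ := h
    exact D.wordVec_mem_fil (l := β :: l) (by rw [wt_cons]; linarith)
  | zero => rw [lie_zero]; exact zero_mem _
  | add a b _ _ ha hb => rw [lie_add]; exact add_mem ha hb
  | smul s a _ ha => rw [hS.lie_smul]; exact Submodule.smul_mem _ _ ha

/-- Modulo `Z''` the element `a` is a multiple of a letter of degree `β` or zero, and `Z''` acts by
scalars, which do not raise the weight. -/
lemma lie_mem_fil {β : Q} (hβ : π β ≤ 0) {a : g} (ha : a ∈ 𝔤 β) {d : ℤ} {u : V}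
    (hu : u ∈ D.fil S v d) : ⁅a, u⁆ ∈ D.fil S v (d + (π D.top - π β)) := by
  have htop := D.top_pos
  obtain ⟨z, hz, h⟩ := D.span β hβ a ha
  obtain ⟨s, hs⟩ := hS.lie_center z hz
  have hz' : ⁅z, u⁆ ∈ D.fil S v (d + (π D.top - π β)) := by
    rw [hs]
    exact Submodule.smul_mem _ _ (D.mem_fil_of_le (by linarith) hu)
  rcases h with rfl | ⟨j, c, rfl, rfl⟩
  · exact hz'
  · rw [add_lie, smul_lie]
    exact add_mem (Submodule.smul_of_tower_mem _ c (D.lie_x_mem_fil hS j hu)) hz'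

omit [LieModule ℂ g V] in
lemma sub_mem_fil_of_wordVec {y : g} {c : ℂ} {k : ℤ}
    (h : ∀ l, ⁅y, D.wordVec v l⁆ - c • D.wordVec v l ∈ D.fil S v (D.wt l - k)) {d : ℤ} {u : V}
    (hu : u ∈ D.fil S v d) : ⁅y, u⁆ - c • u ∈ D.fil S v (d - k) := by
  induction hu using Submodule.span_induction with
  | mem u hu =>
    obtain ⟨l, hl, rfl⟩ := hu
    exact D.mem_fil_of_le (by linarith) (h l)
  | zero => rw [lie_zero, smul_zero, sub_zero]; exact zero_mem _
  | add a b _ _ ha hb =>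
    rw [lie_add, smul_add, add_sub_add_comm]
    exact add_mem ha hb
  | smul s a _ ha =>
    rw [hS.lie_smul, smul_comm c s a, ← smul_sub]
    exact Submodule.smul_mem _ _ ha

variable (hv : IsWhittakerVector φ v)
include hv

/-- Moving `y` past `x_β` produces `[y, x_β]` of degree `α + β`. If `π(α + β) ≤ 0`, the bracket
contributes the weight of `x_β` lowered by exactly `π α`; otherwise it acts by a scalar up to lower
terms. -/
lemma lie_wordVec_sub_mem_fil (l : List D.J) : ∀ {α : Q} (_ : 0 < π α) (y : nPos 𝔤 π),
    (y : g) ∈ 𝔤 α →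
      ⁅(y : g), D.wordVec v l⁆ - φ y • D.wordVec v l ∈ D.fil S v (D.wt l - π α) := by
  have htop := D.top_pos
  induction l with
  | nil =>
    intro α hα y hy
    rw [wordVec_nil, hv y, sub_self]
    exact zero_mem _
  | cons β l ih =>
    intro α hα y hy
    have hb : ⁅(y : g), D.x β⁆ ∈ 𝔤 (α + β) := SetLike.GradedBracket.bracket_mem hy (D.x_mem β)
    have hπ : π (α + β) = π α + π β := map_add π α β
    have e : ⁅(y : g), D.wordVec v (β :: l)⁆ - φ y • D.wordVec v (β :: l) =
        ⁅⁅(y : g), D.x β⁆, D.wordVec v l⁆ +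
          ⁅D.x β, ⁅(y : g), D.wordVec v l⁆ - φ y • D.wordVec v l⁆ := by
      rw [wordVec_cons, leibniz_lie, lie_sub, lie_smul]
      abel
    rw [e, wt_cons]
    refine add_mem ?_ (D.mem_fil_of_le (by linarith) (D.lie_x_mem_fil hS β (ih hα y hy)))
    rcases le_or_gt (π (α + β)) 0 with h0 | h0
    · exact D.mem_fil_of_le (by linarith) (D.lie_mem_fil hS h0 hb (D.wordVec_mem_fil le_rfl))
    · let n : nPos 𝔤 π := ⟨⁅(y : g), D.x β⁆, mem_partSum (P := fun m => 0 < m) h0 hb⟩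
      have hn := ih h0 n hb
      have hn' : φ n • D.wordVec v l ∈ D.fil S v (π D.top - π β + D.wt l - π α) := by
        -- `φ n` can be nonzero only when `α + β ≤ α_φ`. Then `π(α + β) ≤ π(α_φ)`, and the word `l`
        -- itself has small enough weight.
        by_cases hlt : D.top < α + β
        · rw [D.apply_eq_zero _ hlt n hb, zero_smul]
          exact zero_mem _
        · have := OrderHomClass.mono π (not_lt.1 hlt)
          exact Submodule.smul_of_tower_mem _ _ (D.wordVec_mem_fil (by linarith))
      rw [← sub_add_cancel ⁅⁅(y : g), D.x β⁆, D.wordVec v l⁆ (φ n • D.wordVec v l)]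
      exact add_mem (D.mem_fil_of_le (by linarith) hn) hn'

lemma lie_sub_mem_fil {α : Q} (hα : 0 < π α) (y : nPos 𝔤 π) (hy : (y : g) ∈ 𝔤 α) {d : ℤ} {u : V}
    (hu : u ∈ D.fil S v d) : ⁅(y : g), u⁆ - φ y • u ∈ D.fil S v (d - π α) :=
  D.sub_mem_fil_of_wordVec hS (fun l => D.lie_wordVec_sub_mem_fil hS hv l hα y hy) hu

-- The commutator of two letters has weight at most the sum of their weights minus `π(α_φ) ≥ 1`, so
-- letters commute modulo lower weight.
omit hv in
lemma wordVec_sub_mem_fil_of_perm {l l' : List D.J} (h : l.Perm l') :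
    D.wordVec v l - D.wordVec v l' ∈ D.fil S v (D.wt l - 1) := by
  have htop := D.top_pos
  induction h with
  | nil => rw [sub_self]; exact zero_mem _
  | cons β _ ih =>
    rw [wordVec_cons, wordVec_cons, ← lie_sub, wt_cons]
    exact D.mem_fil_of_le (by linarith) (D.lie_x_mem_fil hS β ih)
  | swap β γ l =>
    have hβ := D.deg_nonpos β
    have hγ := D.deg_nonpos γ
    have hb : ⁅D.x γ, D.x β⁆ ∈ 𝔤 (γ + β) :=
      SetLike.GradedBracket.bracket_mem (D.x_mem γ) (D.x_mem β)
    have hπ : π (γ + β) = π γ + π β := map_add π _ _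
    simp only [wordVec_cons, wt_cons]
    rw [← lie_lie]
    exact D.mem_fil_of_le (by linarith)
      (D.lie_mem_fil hS (by linarith) hb (D.wordVec_mem_fil le_rfl))
  | trans h1 _ ih1 ih2 =>
    rw [D.wt_perm h1] at ih1 ⊢
    have h := add_mem ih1 ih2
    rwa [sub_add_sub_cancel] at h

/-- Leading terms: on words with letters `≥ β`, the operator `y - φ(y)` with `y` of degree
`α_φ - β` is a multiple of the derivation with respect to the letter `β`. -/
lemma lie_wordVec_sub_count_mem_fil [IsOrderedAddMonoid Q] (β : D.J) (y : nPos 𝔤 π)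
    (hy : (y : g) ∈ 𝔤 (D.top - β))
    (hyx : ⁅(y : g), D.x β⁆ ∈ nPos 𝔤 π) (l : List D.J) (hl : ∀ γ ∈ l, β ≤ γ) :
    ⁅(y : g), D.wordVec v l⁆ - φ y • D.wordVec v l -
        (l.count β * φ ⟨⁅(y : g), D.x β⁆, hyx⟩) • D.wordVec v (l.erase β) ∈
      D.fil S v (D.wt l - (π D.top - π β) - 1) := by
  have htop := D.top_pos
  set c := φ ⟨⁅(y : g), D.x β⁆, hyx⟩ with hc
  induction l with
  | nil =>
    rw [wordVec_nil, hv y, sub_self]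
    simp
  | cons γ l ih =>
    have ih := ih fun δ hδ => hl δ (List.mem_cons_of_mem _ hδ)
    have hγ : β ≤ γ := hl γ List.mem_cons_self
    have hγπ : π β ≤ π γ := OrderHomClass.mono π hγ
    have hb : ⁅(y : g), D.x γ⁆ ∈ 𝔤 (D.top - β + γ) :=
      SetLike.GradedBracket.bracket_mem hy (D.x_mem γ)
    have hπ : π (D.top - β + γ) = π D.top - π β + π γ := by rw [map_add, map_sub]
    have h0 : 0 < π (D.top - β + γ) := by linarith
    let n : nPos 𝔤 π := ⟨⁅(y : g), D.x γ⁆, mem_partSum (P := fun m => 0 < m) h0 hb⟩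
    have hn := D.lie_wordVec_sub_mem_fil (S := S) hS hv l h0 n hb
    have hx := D.lie_x_mem_fil hS γ ih
    rw [lie_sub, lie_sub, lie_smul, lie_smul] at hx
    have hn' := D.mem_fil_of_le (e := D.wt (γ :: l) - (π D.top - π β) - 1)
      (by rw [wt_cons]; linarith) hn
    have hx' := D.mem_fil_of_le (e := D.wt (γ :: l) - (π D.top - π β) - 1)
      (by rw [wt_cons]; linarith) hx
    have hsum := add_mem hn' hx'
    by_cases hβγ : γ = β
    · subst hβγ
      have hnc : φ n = c := rfl
      rw [hnc] at hsum
      rw [List.erase_cons_head, List.count_cons_self, wordVec_cons, leibniz_lie]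
      have hp : ((l.count γ : ℂ) * c) • ⁅D.x γ, D.wordVec v (l.erase γ)⁆ -
          ((l.count γ : ℂ) * c) • D.wordVec v l ∈
            D.fil S v (D.wt (γ :: l) - (π D.top - π γ) - 1) := by
        by_cases hmem : γ ∈ l
        · rw [← smul_sub]
          have := D.wordVec_sub_mem_fil_of_perm (v := v) hS (List.perm_cons_erase hmem).symm
          rw [D.wt_perm (List.perm_cons_erase hmem).symm] at this
          exact Submodule.smul_of_tower_mem _ _ (D.mem_fil_of_le (by rw [wt_cons]; linarith) this)
        · rw [List.count_eq_zero_of_not_mem hmem, Nat.cast_zero, zero_mul, zero_smul, zero_smul,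
            sub_zero]
          exact zero_mem _
      convert add_mem hsum hp using 1
      push_cast
      rw [add_mul, one_mul, add_smul]
      abel
    · have hlt : β < γ := lt_of_le_of_ne hγ (Ne.symm hβγ)
      -- For `γ > β` the bracket has degree `α_φ + (γ - β) > α_φ`, beyond the support of `φ`. The
      -- order of `Q` is essential here, since `π` may not separate `γ` from `β`.
      have hφn : φ n = 0 := by
        refine D.apply_eq_zero _ ?_ n hb
        have : (β : Q) < γ := hlt
        rw [sub_add_eq_add_sub, add_sub_assoc]
        exact lt_add_of_pos_right _ (sub_pos.2 this)
      rw [hφn, zero_smul, sub_zero] at hsum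
      rw [List.erase_cons_tail (by simpa [Subtype.coe_inj] using hβγ), List.count_cons_of_ne hβγ, wordVec_cons,
        wordVec_cons, leibniz_lie]
      convert hsum using 1
      abel

end NegFrame

end Frame

/-! ### Independence and spanning of monomials over `S(Z'')` -/

section Monomials

variable {Q : Type v} [AddCommGroup Q] [LinearOrder Q]
variable {g : Type u} [LieRing g] [LieAlgebra ℂ g]

namespace NegFrame

section Weight

variable {𝔤 : Q → Submodule ℂ g} [SetLike.GradedBracket 𝔤] {π : Q →+o ℤ}
variable {φ : nPos 𝔤 π →ₗ⁅ℂ⁆ ℂ} (D : NegFrame φ)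

lemma wt_nonneg (l : List D.J) : 0 ≤ D.wt l := by
  induction l with
  | nil => exact le_rfl
  | cons β l ih =>
    have := D.top_pos
    have := D.deg_nonpos β
    rw [wt_cons]
    linarith

lemma eq_nil_of_wt_eq_zero {l : List D.J} (h : D.wt l = 0) : l = [] := by
  cases l with
  | nil => rfl
  | cons β l =>
    have := D.top_pos
    have := D.deg_nonpos β
    have := D.wt_nonneg l
    rw [wt_cons] at h
    linarith

variable {V : Type w} [AddCommGroup V] [LieRingModule g V] {S : Type w'} [CommRing S] [Module S V]

lemma fil_eq_bot_of_neg {v : V} {d : ℤ} (hd : d < 0) : D.fil S v d = ⊥ := by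
  refine Submodule.span_eq_bot.2 ?_
  rintro _ ⟨l, hl, rfl⟩
  exact absurd (hl.trans_lt hd) (not_lt_of_ge (D.wt_nonneg l))

lemma wordVec_zero (l : List D.J) : D.wordVec (0 : V) l = 0 := by
  induction l with
  | nil => rfl
  | cons β l ih => rw [wordVec_cons, ih, lie_zero]

lemma map_wordVec [Module ℂ V] {V' : Type*} [AddCommGroup V'] [LieRingModule g V'] [Module ℂ V']
    (F : V →ₗ⁅ℂ,g⁆ V') (v : V) (l : List D.J) : F (D.wordVec v l) = D.wordVec (F v) l := by
  induction l with
  | nil => rfl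
  | cons β l ih => rw [wordVec_cons, LieModuleHom.map_lie, ih, wordVec_cons]

lemma smul_wordVec [Module ℂ V] (hS : IsCentralAction 𝔤 π S V) (s : S) (v : V) (l : List D.J) :
    s • D.wordVec v l = D.wordVec (s • v) l := by
  induction l with
  | nil => rfl
  | cons β l ih => rw [wordVec_cons, ← hS.lie_smul, ih, wordVec_cons]

/-- The vector obtained by applying an ordered monomial to `v`. -/
def monVec (v : V) (m : Multiset D.J) : V := D.wordVec v m.toList

lemma monVec_zero (v : V) : D.monVec v 0 = v := by
  rw [monVec, Multiset.toList_zero, wordVec_nil]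

end Weight

section Independence

variable {𝔤 : Q → Submodule ℂ g} [SetLike.GradedBracket 𝔤] {π : Q →+o ℤ}
variable {φ : nPos 𝔤 π →ₗ⁅ℂ⁆ ℂ} (D : NegFrame φ)
variable {V : Type w} [AddCommGroup V] [LieRingModule g V] [Module ℂ V] [LieModule ℂ g V]
variable {S : Type w'} [CommRing S] [Module S V] [Algebra ℂ S] [IsScalarTower ℂ S V]

omit [LieModule ℂ g V] [Algebra ℂ S] [IsScalarTower ℂ S V] in
lemma smul_monVec_eq_zero (hS : IsCentralAction 𝔤 π S V) {s : S} {v : V} (h : s • v = 0)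
    (m : Multiset D.J) : s • D.monVec v m = 0 := by
  rw [monVec, D.smul_wordVec hS, h, wordVec_zero]

/-- The leading terms of `y - φ(y)` on monomials. -/
lemma lie_monVec_sub_mem_fil [IsOrderedAddMonoid Q] (hS : IsCentralAction 𝔤 π S V) {v : V}
    (hv : IsWhittakerVector φ v) (β : D.J) (y : nPos 𝔤 π) (hy : (y : g) ∈ 𝔤 (D.top - β))
    (hyx : ⁅(y : g), D.x β⁆ ∈ nPos 𝔤 π) (m : Multiset D.J) (hm : ∀ γ ∈ m, β ≤ γ) :
    ⁅(y : g), D.monVec v m⁆ - φ y • D.monVec v m -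
        (if β ∈ m then (m.count β * φ ⟨⁅(y : g), D.x β⁆, hyx⟩) • D.monVec v (m.erase β) else 0) ∈
      D.fil S v (D.wt m.toList - (π D.top - π β) - 1) := by
  have h1 := D.lie_wordVec_sub_count_mem_fil (S := S) hS hv β y hy hyx m.toList
    (fun γ hγ => hm γ (Multiset.mem_toList.1 hγ))
  have hcount : m.toList.count β = m.count β := by
    conv_rhs => rw [← Multiset.coe_toList m, Multiset.coe_count]
    exact List.countP_congr fun γ _ => by simp [Subtype.coe_inj]
  rw [hcount] at h1
  split_ifs with hβ
  · have hp : (m.toList.erase β).Perm (m.erase β).toList := by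
      refine List.Perm.cons_inv (a := β)
        ((List.perm_cons_erase (Multiset.mem_toList.2 hβ)).symm.trans ?_)
      rw [← Multiset.coe_eq_coe, ← Multiset.cons_coe, Multiset.coe_toList, Multiset.coe_toList,
        Multiset.cons_erase hβ]
    have hw : D.wt m.toList = π D.top - π β + D.wt (m.toList.erase β) := by
      rw [← wt_cons]
      exact D.wt_perm (List.perm_cons_erase (Multiset.mem_toList.2 hβ))
    have h2 := D.wordVec_sub_mem_fil_of_perm (S := S) (v := v) hS hp
    have h3 := add_mem h1 (Submodule.smul_of_tower_mem _ (m.count β * φ ⟨⁅(y : g), D.x β⁆, hyx⟩)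
      (D.mem_fil_of_le (by linarith) h2))
    rw [smul_sub, sub_add_sub_cancel] at h3
    exact h3
  · rw [Multiset.count_eq_zero_of_notMem hβ, Nat.cast_zero, zero_mul, zero_smul] at h1
    exact h1

/-- Monomials of the same weight are linearly independent modulo terms of lower weight, up to
scalars that kill the Whittaker vector. -/
lemma smul_eq_zero_of_sum_mem_fil [IsOrderedAddMonoid Q] (hS : IsCentralAction 𝔤 π S V) {v : V}
    (hv : IsWhittakerVector φ v) (n : ℕ) : ∀ (d : ℤ) (_ : d ≤ n) (s : Finset (Multiset D.J))
    (f : Multiset D.J → S), (∀ m ∈ s, D.wt m.toList = d) →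
      ∑ m ∈ s, f m • D.monVec v m ∈ D.fil S v (d - 1) → ∀ m ∈ s, f m • v = 0 := by
  classical
  induction n with
  | zero =>
    intro d hd s f hs hsum m hm
    have h0 : ∀ m ∈ s, m = 0 := fun m hm => by
      have h1 : D.wt m.toList = 0 :=
        le_antisymm (by rw [hs m hm]; exact_mod_cast hd) (D.wt_nonneg _)
      exact Multiset.toList_eq_nil.1 (D.eq_nil_of_wt_eq_zero h1)
    have hs' : s = {0} := Finset.eq_singleton_iff_unique_mem.2 ⟨h0 m hm ▸ hm, h0⟩
    rw [D.fil_eq_bot_of_neg (by push_cast at hd; linarith), Submodule.mem_bot, hs',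
      Finset.sum_singleton, monVec_zero] at hsum
    rw [h0 m hm, hsum]
  | succ n ih =>
    intro d hd s f hs hsum m₀ hm₀
    by_cases hdn : d ≤ n
    · exact ih d hdn s f hs hsum m₀ hm₀
    by_contra hne
    -- A coefficient that kills `v` kills every monomial applied to `v`, so such terms can be
    -- discarded before the smallest letter `β` is chosen.
    let s₁ := s.filter fun m => f m • v ≠ 0
    have hm₁ : m₀ ∈ s₁ := Finset.mem_filter.2 ⟨hm₀, hne⟩
    have hsum₁ : ∑ m ∈ s₁, f m • D.monVec v m ∈ D.fil S v (d - 1) := by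
      rw [Finset.sum_filter_of_ne]
      · exact hsum
      · intro m _ h h'
        exact h (D.smul_monVec_eq_zero hS h' m)
    have hm₀' : m₀ ≠ 0 := by
      rintro rfl
      have := hs 0 hm₀
      rw [Multiset.toList_zero, wt_nil] at this
      omega
    obtain ⟨γ₀, hγ₀⟩ := Multiset.exists_mem_of_ne_zero hm₀'
    obtain ⟨β, hβ, hβmin⟩ := (s₁.biUnion Multiset.toFinset).exists_min_image id
      ⟨γ₀, Finset.mem_biUnion.2 ⟨m₀, hm₁, Multiset.mem_toFinset.2 hγ₀⟩⟩
    obtain ⟨m₁, hm₁, hβm₁⟩ := Finset.mem_biUnion.1 hβ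
    rw [Multiset.mem_toFinset] at hβm₁
    have hmin : ∀ m ∈ s₁, ∀ γ ∈ m, β ≤ γ := fun m hm γ hγ =>
      hβmin γ (Finset.mem_biUnion.2 ⟨m, hm, Multiset.mem_toFinset.2 hγ⟩)
    obtain ⟨y₀, hy, hyx, hφ⟩ := D.pairing β
    have htop := D.top_pos
    have hβ0 := D.deg_nonpos β
    have hπ : π (D.top - β) = π D.top - π β := map_sub π _ _
    have hpos : 0 < π (D.top - β) := by linarith
    let y : nPos 𝔤 π := ⟨y₀, mem_partSum (P := fun m => 0 < m) hpos hy⟩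
    set c := φ ⟨⁅y₀, D.x β⁆, hyx⟩ with hc
    -- `T` lowers the weight of the whole sum by that of `β`. Comparison with its leading term on
    -- each monomial leaves a relation among the derivatives.
    let T : V →ₗ[ℂ] V := LieModule.toEnd ℂ g V y₀ - φ y • LinearMap.id
    have hT : ∀ u, T u = ⁅(y : g), u⁆ - φ y • u := fun u => rfl
    have hTS : ∀ (s : S) (u : V), T (s • u) = s • T u := fun s u => by
      rw [hT, hT, hS.lie_smul, smul_comm, smul_sub]
    have h1 := D.lie_sub_mem_fil hS hv hpos y hy hsum₁
    rw [← hT, map_sum] at h1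
    have h2 : ∑ m ∈ s₁, (T (f m • D.monVec v m) - f m •
        (if β ∈ m then (m.count β * c) • D.monVec v (m.erase β) else 0)) ∈
          D.fil S v (d - (π D.top - π β) - 1) := by
      refine sum_mem fun m hm => ?_
      rw [hTS, ← smul_sub]
      have h := D.lie_monVec_sub_mem_fil (S := S) hS hv β y hy hyx m (hmin m hm)
      rw [hs m (Finset.mem_filter.1 hm).1] at h
      exact Submodule.smul_mem _ _ h
    rw [Finset.sum_sub_distrib] at h2
    have h3 := sub_mem (D.mem_fil_of_le (by linarith) h1) h2
    rw [sub_sub_cancel] at h3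
    let s₂ := s₁.filter fun m => β ∈ m
    -- Distinct monomials containing `β` have distinct derivatives up to scalars, so no terms merge.
    have hinj : Set.InjOn (fun m : Multiset D.J => m.erase β) s₂ := by
      intro m hm m' hm' h
      rw [← Multiset.cons_erase (Finset.mem_filter.1 hm).2,
        ← Multiset.cons_erase (Finset.mem_filter.1 hm').2]
      exact congrArg _ h
    -- The shift by one makes the value at `m.erase β` equal to `c` times the multiplicity of `β` in
    -- `m` times `f m`.
    let f' : Multiset D.J → S := fun m => ((m.count β + 1 : ℂ) * c) • f (β ::ₘ m)
    have hf' : ∀ m ∈ s₂, f' (m.erase β) = ((m.count β : ℂ) * c) • f m := fun m hm => by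
      have hβm := (Finset.mem_filter.1 hm).2
      have hcount : m.count β = (m.erase β).count β + 1 := by
        conv_lhs => rw [← Multiset.cons_erase hβm, Multiset.count_cons_self]
      simp only [f']
      rw [Multiset.cons_erase hβm, hcount]
      push_cast
      rfl
    have h4 : ∑ m ∈ s₂.image (fun m => m.erase β), f' m • D.monVec v m ∈
        D.fil S v (d - (π D.top - π β) - 1) := by
      rw [Finset.sum_image hinj]
      convert h3 using 1
      rw [Finset.sum_filter]
      refine Finset.sum_congr rfl fun m hm => ?_
      split_ifs with hβm
      · rw [hf' m (Finset.mem_filter.2 ⟨hm, hβm⟩), smul_assoc, smul_comm]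
      · rw [smul_zero]
    have hm₂ : m₁ ∈ s₂ := Finset.mem_filter.2 ⟨hm₁, hβm₁⟩
    have h5 := ih (d - (π D.top - π β)) (by push_cast at hd; linarith)
      (s₂.image fun m => m.erase β) f' (by
        intro m' hm'
        obtain ⟨m, hm, rfl⟩ := Finset.mem_image.1 hm'
        have hβm := (Finset.mem_filter.1 hm).2
        have hp : m.toList.Perm (β :: (m.erase β).toList) := by
          rw [← Multiset.coe_eq_coe, ← Multiset.cons_coe, Multiset.coe_toList, Multiset.coe_toList,
            Multiset.cons_erase hβm]
        have hw := D.wt_perm hp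
        rw [wt_cons, hs m (Finset.mem_filter.1 (Finset.mem_filter.1 hm).1).1] at hw
        linarith) h4 (m₁.erase β) (Finset.mem_image_of_mem _ hm₂)
    rw [hf' m₁ hm₂, smul_assoc] at h5
    refine (Finset.mem_filter.1 hm₁).2 ((smul_eq_zero.1 h5).resolve_left ?_)
    exact mul_ne_zero (Nat.cast_ne_zero.2 (Multiset.count_ne_zero.2 hβm₁)) hφ

/-- The ordered monomials are linearly independent in a Whittaker module, up to scalars that kill
the Whittaker vector. -/
theorem smul_eq_zero_of_sum_eq_zero [IsOrderedAddMonoid Q] (hS : IsCentralAction 𝔤 π S V) {v : V}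
    (hv : IsWhittakerVector φ v) (s : Finset (Multiset D.J)) (f : Multiset D.J → S)
    (hsum : ∑ m ∈ s, f m • D.monVec v m = 0) : ∀ m ∈ s, f m • v = 0 := by
  classical
  intro m₀ hm₀
  by_contra hne
  let s₁ := s.filter fun m => f m • v ≠ 0
  have hsum₁ : ∑ m ∈ s₁, f m • D.monVec v m = 0 := by
    rw [Finset.sum_filter_of_ne]
    · exact hsum
    · intro m _ h h'
      exact h (D.smul_monVec_eq_zero hS h' m)
  -- In the surviving terms of largest weight, the relation expresses their sum through terms of
  -- lower weight.
  obtain ⟨m₁, hm₁, hmax⟩ := s₁.exists_max_image (fun m => D.wt m.toList)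
    ⟨m₀, Finset.mem_filter.2 ⟨hm₀, hne⟩⟩
  rw [← Finset.sum_filter_add_sum_filter_not s₁ (fun m => D.wt m.toList = D.wt m₁.toList),
    add_eq_zero_iff_eq_neg] at hsum₁
  refine (Finset.mem_filter.1 hm₁).2 (D.smul_eq_zero_of_sum_mem_fil hS hv
    (D.wt m₁.toList).toNat (D.wt m₁.toList) (Int.self_le_toNat _)
    (s₁.filter fun m => D.wt m.toList = D.wt m₁.toList) f
    (fun m hm => (Finset.mem_filter.1 hm).2) ?_ m₁ (Finset.mem_filter.2 ⟨hm₁, rfl⟩))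
  rw [hsum₁]
  refine neg_mem (sum_mem fun m hm => Submodule.smul_mem _ _ (D.wordVec_mem_fil ?_))
  obtain ⟨hm, hm'⟩ := Finset.mem_filter.1 hm
  have := lt_of_le_of_ne (hmax m hm) hm'
  omega

/-- Rearranging a word into the chosen listing of its multiset costs only terms of lower weight, and
the filtration vanishes in negative weight. -/
lemma fil_le_span_monVec (hS : IsCentralAction 𝔤 π S V) (v : V) (n : ℕ) :
    ∀ d : ℤ, d < n → D.fil S v d ≤ Submodule.span S (Set.range (D.monVec v)) := by
  induction n with
  | zero =>
    intro d hd
    rw [D.fil_eq_bot_of_neg (by exact_mod_cast hd)]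
    exact bot_le
  | succ n ih =>
    intro d hd
    refine Submodule.span_le.2 ?_
    rintro _ ⟨l, hl, rfl⟩
    have hp : l.Perm (l : Multiset D.J).toList := by
      rw [← Multiset.coe_eq_coe, Multiset.coe_toList]
    have h := ih (D.wt l - 1) (by push_cast at hd; linarith)
      (D.wordVec_sub_mem_fil_of_perm (S := S) (v := v) hS hp)
    rw [SetLike.mem_coe, ← sub_add_cancel (D.wordVec v l) (D.wordVec v (l : Multiset D.J).toList)]
    exact add_mem h (Submodule.subset_span ⟨_, rfl⟩)

end Independence

section Spanning

variable {𝔤 : Q → Submodule ℂ g} [GradedLieAlgebra 𝔤] {π : Q →+o ℤ}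
variable {φ : nPos 𝔤 π →ₗ⁅ℂ⁆ ℂ} (D : NegFrame φ)
variable {V : Type w} [AddCommGroup V] [LieRingModule g V] [Module ℂ V] [LieModule ℂ g V]
variable {S : Type w'} [CommRing S] [Module S V] [Algebra ℂ S] [IsScalarTower ℂ S V]

/-- The ordered monomials span a Whittaker module. -/
theorem span_monVec_eq_top (hS : IsCentralAction 𝔤 π S V) {v : V} (hv : IsWhittakerVector φ v)
    (hgen : LieSubmodule.lieSpan ℂ g {v} = ⊤) :
    Submodule.span S (Set.range (D.monVec v)) = ⊤ := by
  have hfil : ∀ d, D.fil S v d ≤ Submodule.span S (Set.range (D.monVec v)) := fun d =>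
    D.fil_le_span_monVec hS v (d.toNat + 1) d (by push_cast; linarith [Int.self_le_toNat d])
  -- The span contains every filtration step, and a homogeneous element maps a monomial into some
  -- step, up to the scalar `φ` when its degree is positive.
  have key : ∀ a : g, ∀ u ∈ Submodule.span S (Set.range (D.monVec v)),
      ⁅a, u⁆ ∈ Submodule.span S (Set.range (D.monVec v)) := by
    intro a u hu
    have ha : a ∈ ⨆ α, 𝔤 α := by
      rw [(DirectSum.Decomposition.isInternal 𝔤).submodule_iSup_eq_top]
      trivial
    induction hu using Submodule.span_induction with
    | zero => rw [lie_zero]; exact zero_mem _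
    | add b c _ _ hb hc => rw [lie_add]; exact add_mem hb hc
    | smul s b _ hb => rw [hS.lie_smul]; exact Submodule.smul_mem _ _ hb
    | mem u hu =>
      obtain ⟨m, rfl⟩ := hu
      induction ha using Submodule.iSup_induction' with
      | zero => rw [zero_lie]; exact zero_mem _
      | add b c _ _ hb hc => rw [add_lie]; exact add_mem hb hc
      | mem α a ha =>
        have hm : D.monVec v m ∈ D.fil S v (D.wt m.toList) := D.wordVec_mem_fil le_rfl
        rcases le_or_gt (π α) 0 with h | h
        · exact hfil _ (D.lie_mem_fil hS h ha hm)
        · let y : nPos 𝔤 π := ⟨a, mem_partSum (P := fun m => 0 < m) h ha⟩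
          have h' := hfil _ (D.lie_sub_mem_fil hS hv h y ha hm)
          rw [← sub_add_cancel ⁅a, D.monVec v m⁆ (φ y • D.monVec v m)]
          exact add_mem h' (Submodule.smul_of_tower_mem _ _ (Submodule.subset_span ⟨m, rfl⟩))
  let N : LieSubmodule ℂ g V :=
    { (Submodule.span S (Set.range (D.monVec v))).restrictScalars ℂ with
      lie_mem := fun {a u} hu => key a u hu }
  have hN : (⊤ : LieSubmodule ℂ g V) ≤ N := by
    rw [← hgen, LieSubmodule.lieSpan_le]
    rintro _ rfl
    exact Submodule.subset_span ⟨0, D.monVec_zero _⟩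
  exact eq_top_iff.2 fun u _ => hN (LieSubmodule.mem_top u)

end Spanning

end NegFrame

end Monomials

/-! ### Recovering a Whittaker module from its annihilator -/

section LeftInverse

variable {Q : Type v} [AddCommGroup Q] [LinearOrder Q]
variable {g : Type u} [LieRing g] [LieAlgebra ℂ g]

section CentralModule

variable (𝔤 : Q → Submodule ℂ g) [SetLike.GradedBracket 𝔤] (π : Q →+o ℤ)
variable (V : Type w) [AddCommGroup V] [Module ℂ V] [LieRingModule g V] [LieModule ℂ g V]

/-- A `𝔤`-module as a module over `S(Z'')`. -/
abbrev moduleSZ : Module (SZ 𝔤 π) V :=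
  Module.compHom V ((envAction g V).comp (SZToEnv 𝔤 π)).toRingHom

lemma isScalarTower_moduleSZ :
    let _ := moduleSZ 𝔤 π V
    IsScalarTower ℂ (SZ 𝔤 π) V := by
  intro _
  refine ⟨fun c s x => ?_⟩
  change envAction g V (SZToEnv 𝔤 π (c • s)) x = c • envAction g V (SZToEnv 𝔤 π s) x
  rw [map_smul, map_smul, LinearMap.smul_apply]

lemma isCentralAction_moduleSZ :
    let _ := moduleSZ 𝔤 π V
    IsCentralAction 𝔤 π (SZ 𝔤 π) V := by
  intro _
  refine ⟨fun a s x => ?_, fun z hz => ⟨SymmetricAlgebra.ι ℂ _ ⟨z, hz⟩, fun x => ?_⟩⟩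
  · change ⁅a, envAction g V (SZToEnv 𝔤 π s) x⁆ = envAction g V (SZToEnv 𝔤 π s) ⁅a, x⁆
    rw [← envAction_ι, ← envAction_ι, envAction_SZToEnv_comm]
  · change _ = envAction g V (SZToEnv 𝔤 π (SymmetricAlgebra.ι ℂ _ ⟨z, hz⟩)) x
    rw [SZToEnv_ι, envAction_ι]

end CentralModule

variable {𝔤 : Q → Submodule ℂ g} [GradedLieAlgebra 𝔤] {π : Q →+o ℤ} [IsOrderedAddMonoid Q]
variable {φ : nPos 𝔤 π →ₗ⁅ℂ⁆ ℂ}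
variable {V : Type w} [AddCommGroup V] [Module ℂ V] [LieRingModule g V] [LieModule ℂ g V]

/-- Expand an element of the kernel in monomials over `S(Z'')`. Its image is the same combination of
monomials applied to `v`, so independence puts every coefficient into `A_V`. -/
theorem NegFrame.ker_le_idealMul (D : NegFrame φ) {v : V} (hv : IsWhittakerVector φ v)
    (hgen : LieSubmodule.lieSpan ℂ g {v} = ⊤) (F : Mφ φ →ₗ⁅ℂ,g⁆ V) (hF : F (wφ φ) = v) :
    F.ker ≤ idealMul φ (annIdeal 𝔤 π V) := by
  let _ := moduleSZ 𝔤 π V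
  let _ := moduleSZ 𝔤 π (Mφ φ)
  have := isScalarTower_moduleSZ 𝔤 π V
  have := isScalarTower_moduleSZ 𝔤 π (Mφ φ)
  have hV := isCentralAction_moduleSZ 𝔤 π V
  have hM := isCentralAction_moduleSZ 𝔤 π (Mφ φ)
  have hFS : ∀ (s : SZ 𝔤 π) (m : Mφ φ), F (s • m) = s • F m := fun s m => envAction_map F _ m
  intro m hm
  have hm0 : F m = 0 := hm
  have hspan := D.span_monVec_eq_top hM (isWhittakerVector_wφ φ) (lieSpan_wφ φ)
  obtain ⟨f, rfl⟩ := Finsupp.mem_span_range_iff_exists_finsupp.1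
    (hspan ▸ (Submodule.mem_top : m ∈ (⊤ : Submodule (SZ 𝔤 π) (Mφ φ))))
  have hmon : ∀ μ, F (D.monVec (wφ φ) μ) = D.monVec v μ := fun μ => by
    rw [NegFrame.monVec, D.map_wordVec, hF]
    rfl
  rw [Finsupp.sum, map_sum] at hm0
  simp only [hFS, hmon] at hm0
  have h0 := D.smul_eq_zero_of_sum_eq_zero hV hv f.support f hm0
  refine sum_mem fun μ hμ => LieSubmodule.subset_lieSpan ?_
  exact ⟨f μ, (mem_annIdeal_of_generator hgen).2 (h0 μ hμ), _, envAction_Mφ φ _ _⟩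

/-- A Whittaker module `V` of type `φ` is isomorphic to `M_φ / A_V M_φ`. -/
theorem nonempty_Lφ_annIdeal_equiv (hgood : IsQGood 𝔤 π) (hns : IsNonsingular 𝔤 π φ)
    (hV : IsWhittakerModule φ V) : Nonempty (Lφ φ (annIdeal 𝔤 π V) ≃ₗ⁅ℂ,g⁆ V) := by
  obtain ⟨D⟩ := exists_negFrame hgood hns
  obtain ⟨v, hv, hgen⟩ := hV
  obtain ⟨F, hF⟩ := exists_lieModuleHom_of_isWhittakerVector hv
  have hker : idealMul φ (annIdeal 𝔤 π V) = F.ker := by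
    refine le_antisymm (idealMul_le_ker F fun p hp => ?_) (D.ker_le_idealMul hv hgen F hF)
    rw [hF]
    exact (mem_annIdeal_of_generator hgen).1 hp
  have hsurj : Function.Surjective F := by
    have h : (⊤ : LieSubmodule ℂ g V) ≤ F.range := by
      rw [← hgen, LieSubmodule.lieSpan_le]
      rintro _ rfl
      exact (LieModuleHom.mem_range F _).2 ⟨_, hF⟩
    exact fun u => (LieModuleHom.mem_range F u).1 (h (LieSubmodule.mem_top u))
  let e : Lφ φ (annIdeal 𝔤 π V) ≃ₗ[ℂ] V :=
    (Submodule.quotEquivOfEq _ _ (congrArg LieSubmodule.toSubmodule hker)).trans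
      ((F : Mφ φ →ₗ[ℂ] V).quotKerEquivOfSurjective hsurj)
  refine ⟨{ e with map_lie' := fun {a u} => ?_, invFun := e.symm }⟩
  obtain ⟨m, rfl⟩ := LieSubmodule.Quotient.surjective_mk' _ u
  rw [← LieModuleHom.map_lie]
  exact F.map_lie a m

end LeftInverse

end GradedWhittaker

end

theorem theorem4p2p2
    {Q : Type*} [AddCommGroup Q] [LinearOrder Q] [IsOrderedAddMonoid Q] [Module.Free ℤ Q]
    {g : Type*} [LieRing g] [LieAlgebra ℂ g]
    (𝔤 : Q → Submodule ℂ g) [GradedLieAlgebra 𝔤] (π : Q →+o ℤ)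
    (hgood : GradedWhittaker.IsQGood 𝔤 π)
    (φ : GradedWhittaker.nPos 𝔤 π →ₗ⁅ℂ⁆ ℂ)
    (hns : GradedWhittaker.IsNonsingular 𝔤 π φ) :
    Function.Bijective (GradedWhittaker.annClass φ) ∧
      Function.LeftInverse (GradedWhittaker.idealClass φ) (GradedWhittaker.annClass φ) ∧
      Function.RightInverse (GradedWhittaker.idealClass φ) (GradedWhittaker.annClass φ) := by
  have hl : Function.LeftInverse (GradedWhittaker.idealClass φ)
      (GradedWhittaker.annClass φ) := by
    intro c
    induction c using Quotient.inductionOn with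
    | h V =>
      exact Quotient.sound (GradedWhittaker.nonempty_Lφ_annIdeal_equiv hgood hns V.isWhittakerModule)
  have hr : Function.RightInverse (GradedWhittaker.idealClass φ)
      (GradedWhittaker.annClass φ) := GradedWhittaker.annIdeal_Lφ φ
  exact ⟨⟨hl.injective, hr.surjective⟩, hl, hr⟩
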